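/- Let $k$ be a field and $n\ge 0$ an integer. Let $U_n$ be the open subscheme of the affine space over $k$ of all tuples $(A,B,C,v)$ of three $n\times n$ matrices and a vector of length $n$ consisting of the points at which the tuple is cyclic, i.e. $v$ generates the $n$-dimensional vector space (over the residue field) under the action of $A,B,C$. Let $GL_n$ act on $U_n$ by $g\cdot(A,B,C,v)=(gAg^{-1},gBg^{-1},gCg^{-1},gv)$. (1) The quotient $\pi\colon U_n\to M_n=U_n/GL_n$ exists as a $k$-scheme, in the following sense: for every $k$-scheme $T$, two $T$-points of $U_n$ have the same image in $M_n$ if and only if they are conjugate under $GL_n(\Gamma(T,\mathcal O_T))$, and $\pi$ has sections Zariski-locally on $M_n$. For every such quotient $\pi\colon U_n\to M_n$: (2) $M_n$ is smooth over $k$, and there is a unique function $f_n\in\Gamma(M_n,\mathcal O)$ with $\pi^*f_n=\mathrm{Tr}([A,B]C)$. (3) The critical locus $\{df_n=0\}\subset M_n$, i.e. the closed subscheme $Z$ whose ideal on each affine open $W$ is generated by the contractions of $df_n$ with the $\mathcal O(W)$-linear forms on $\Omega_{\mathcal O(W)/k}$, exists, and for every scheme $T$ and $T$-point $p$ of $U_n$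 the point $\pi\circ p$ factors through $Z$ if and only if the matrices $A,B,C$ of $p$ commute pairwise. (4) $Z$ is the Hilbert scheme $\mathrm{Hilb}^n(\mathbb A^3)$: for $k$-algebras $R$ there is a bijection, natural in $R$, between the $R$-points of $Z$ and the ideals $J\subset R[x_1,x_2,x_3]$ such that $R[x_1,x_2,x_3]/J$ is a finite projective $R$-module of constant rank $n$. Under this bijection, if the image in $M_n$ of an $R$-point $(A_1,A_2,A_3,v)$ of $U_n$ is an $R$-point of $Z$ with corresponding ideal $J$, then there is an isomorphism of $R$-modules $R[x_1,x_2,x_3]/J\cong R^n$ taking $1$ to $v$ and multiplication by $x_i$ to $A_i$. (5) For every commutative $k$-algebra $R$ and every tuple $(A,B,C,v)$ over $R$, all partial derivatives of the polynomial $\mathrm{Tr}([A,B]C)$ with respect to the entries of $A,B,C,v$ vanish at the tuple if and only if $A,B,C$ commute pairwise. -/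

import Mathlib

open AlgebraicGeometry CategoryTheory Matrix

universe u

noncomputable section

namespace HilbCrit

/-- A framed triple over a commutative ring `S`: three `n × n` matrices `A 0, A 1, A 2`
together with a vector `v`. -/
@[ext]
structure FramedTriple (n : ℕ) (S : Type*) where
  A : Fin 3 → Matrix (Fin n) (Fin n) S
  v : Fin n → S

/-- The coordinates on the space of framed triples: matrix entries and vector entries. -/
abbrev Coord (n : ℕ) : Type := (Fin 3 × Fin n × Fin n) ⊕ Fin n

namespace FramedTriple

variable {n : ℕ} {S S' : Type*}

/-- Base change of a framed triple along a ring homomorphism. -/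
def map [CommRing S] [CommRing S'] (φ : S →+* S') (t : FramedTriple n S) : FramedTriple n S' where
  A i := (t.A i).map φ
  v j := φ (t.v j)

/-- The coordinate vector of a framed triple. -/
def coords (t : FramedTriple n S) : Coord n → S :=
  Sum.elim (fun c => t.A c.1 c.2.1 c.2.2) t.v

/-- The action of `GL_n`: conjugation on the matrices, the standard action on the vector. -/
instance [CommRing S] : SMul (GL (Fin n) S) (FramedTriple n S) where
  smul g t :=
    { A := fun i => (g : Matrix (Fin n) (Fin n) S) * t.A i * (↑g⁻¹ : Matrix (Fin n) (Fin n) S)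
      v := (g : Matrix (Fin n) (Fin n) S) *ᵥ t.v }

/-- `v` generates `S ^ n` under the action of the three matrices: every submodule that contains
`v` and is stable under the matrices is everything. -/
def IsCyclic [CommRing S] (t : FramedTriple n S) : Prop :=
  ∀ N : Submodule S (Fin n → S), t.v ∈ N → (∀ i, ∀ m ∈ N, t.A i *ᵥ m ∈ N) → N = ⊤

/-- The three matrices commute pairwise. -/
def PairwiseCommute [CommRing S] (t : FramedTriple n S) : Prop :=
  ∀ i j, t.A i * t.A j = t.A j * t.A i

/-- The function `Tr([A, B] C)`. -/
def potential [CommRing S] (t : FramedTriple n S) : S :=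
  ((t.A 0 * t.A 1 - t.A 1 * t.A 0) * t.A 2).trace

/-- The value of a noncommutative word in the matrices, applied to `v`. -/
def word [CommRing S] (t : FramedTriple n S) : List (Fin 3) → Fin n → S
  | [] => t.v
  | i :: w => t.A i *ᵥ t.word w

/-- The determinant of the `n` vectors obtained by applying `n` given words to `v`. -/
def wordDet [CommRing S] (t : FramedTriple n S) (f : Fin n → List (Fin 3)) : S :=
  (Matrix.of fun i j => t.word (f j) i).det

lemma word_map [CommRing S] [CommRing S'] (φ : S →+* S') (t : FramedTriple n S)
    (w : List (Fin 3)) : (t.map φ).word w = fun j => φ (t.word w j) := by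
  induction w with
  | nil => rfl
  | cons i w ih =>
    funext j
    simp only [word, ih]
    exact (RingHom.map_mulVec φ (t.A i) (t.word w) j).symm

lemma wordDet_map [CommRing S] [CommRing S'] (φ : S →+* S') (t : FramedTriple n S)
    (f : Fin n → List (Fin 3)) : (t.map φ).wordDet f = φ (t.wordDet f) := by
  rw [wordDet, wordDet, RingHom.map_det]
  congr 1
  ext i j
  simp [word_map]

lemma isCyclic_iff [Field S] (t : FramedTriple n S) :
    t.IsCyclic ↔ ∃ f, t.wordDet f ≠ 0 := by
  constructor
  · intro h
    have htop : Submodule.span S (Set.range t.word) = ⊤ := by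
      refine h _ (Submodule.subset_span ⟨[], rfl⟩) fun i m hm => ?_
      induction hm using Submodule.span_induction with
      | mem x hx =>
        obtain ⟨w, rfl⟩ := hx
        exact Submodule.subset_span ⟨i :: w, rfl⟩
      | zero => simp
      | add x y _ _ hx hy => rw [Matrix.mulVec_add]; exact add_mem hx hy
      | smul a x _ hx => rw [Matrix.mulVec_smul]; exact Submodule.smul_mem _ a hx
    obtain ⟨g, hg, hspan, hli⟩ :=
      Submodule.exists_fun_fin_finrank_span_eq S (Set.range t.word)
    have hn : Module.finrank S (Submodule.span S (Set.range t.word)) = n := by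
      rw [htop]; simp
    choose f hf using hg
    refine ⟨fun j => f (Fin.cast hn.symm j), ?_⟩
    have hli' : LinearIndependent S
        (fun j : Fin n => t.word (f (Fin.cast hn.symm j))) := by
      simp only [hf]
      exact hli.comp _ (Fin.cast_injective _)
    have := (Matrix.linearIndependent_cols_iff_isUnit
      (A := Matrix.of fun i j => t.word (f (Fin.cast hn.symm j)) i)).1 hli'
    exact ((Matrix.isUnit_iff_isUnit_det _).1 this).ne_zero
  · rintro ⟨f, hf⟩ N hv hN
    have hw : ∀ w, t.word w ∈ N := by
      intro w
      induction w with
      | nil => exact hv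
      | cons i w ih => exact hN i _ ih
    rw [eq_top_iff]
    intro x _
    set P : Matrix (Fin n) (Fin n) S := Matrix.of fun i j => t.word (f j) i with hP
    have hx : x = ∑ j, (P⁻¹ *ᵥ x) j • t.word (f j) := by
      have h1 : P *ᵥ (P⁻¹ *ᵥ x) = x := by
        rw [Matrix.mulVec_mulVec, Matrix.mul_nonsing_inv _ (isUnit_iff_ne_zero.2 hf),
          Matrix.one_mulVec]
      conv_lhs => rw [← h1]
      funext i
      simp [Matrix.mulVec, dotProduct, hP, mul_comm]
    rw [hx]
    exact Submodule.sum_mem _ fun j _ => Submodule.smul_mem _ _ (hw _)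

end FramedTriple

/-- The generic framed triple, over the polynomial ring in all the coordinates. -/
def generic (k : Type u) [Field k] (n : ℕ) : FramedTriple n (MvPolynomial (Coord n) k) where
  A i := Matrix.of fun a b => MvPolynomial.X (Sum.inl (i, a, b))
  v j := MvPolynomial.X (Sum.inr j)

/-- The affine space of all framed triples over `k`. -/
abbrev tripleSpace (k : Type u) [Field k] (n : ℕ) : Scheme.{u} :=
  Spec (CommRingCat.of (MvPolynomial (Coord n) k))

lemma isOpen_cyclic (k : Type u) [Field k] (n : ℕ) :
    IsOpen {x : PrimeSpectrum (MvPolynomial (Coord n) k) |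
      ((generic k n).map (algebraMap _ x.asIdeal.ResidueField)).IsCyclic} := by
  have : {x : PrimeSpectrum (MvPolynomial (Coord n) k) |
      ((generic k n).map (algebraMap _ x.asIdeal.ResidueField)).IsCyclic} =
      ⋃ f, (PrimeSpectrum.basicOpen ((generic k n).wordDet f) :
        Set (PrimeSpectrum (MvPolynomial (Coord n) k))) := by
    ext x
    simp [FramedTriple.isCyclic_iff, FramedTriple.wordDet_map]
  rw [this]
  exact isOpen_iUnion fun f => (PrimeSpectrum.basicOpen _).isOpen

/-- The open locus of cyclic triples: the points `x` at which the vector generates `κ(x) ^ n`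
under the three matrices. -/
def cyclicLocus (k : Type u) [Field k] (n : ℕ) : (tripleSpace k n).Opens where
  carrier := {x : PrimeSpectrum (MvPolynomial (Coord n) k) |
    ((generic k n).map (algebraMap _ x.asIdeal.ResidueField)).IsCyclic}
  is_open' := isOpen_cyclic k n

/-- The scheme of cyclic framed triples, an open subscheme of an affine space. -/
abbrev cyclicTriples (k : Type u) [Field k] (n : ℕ) : Scheme.{u} := (cyclicLocus k n).toScheme

/-- The structure morphism of the scheme of cyclic framed triples. -/
def cyclicTriplesStr (k : Type u) [Field k] (n : ℕ) :
    cyclicTriples k n ⟶ Spec (CommRingCat.of k) :=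
  (cyclicLocus k n).ι ≫ Spec.map (CommRingCat.ofHom MvPolynomial.C)

variable {k : Type u} [Field k] {n : ℕ}

/-- The cyclic framed triple of global functions on `T` that corresponds to a `T`-valued point of
the scheme of cyclic framed triples. -/
def pointTriple {T : Scheme.{u}} (p : T ⟶ cyclicTriples k n) : FramedTriple n Γ(T, ⊤) :=
  (generic k n).map
    ((Scheme.ΓSpecIso (CommRingCat.of (MvPolynomial (Coord n) k))).inv ≫
      (p ≫ (cyclicLocus k n).ι).appTop).hom

/-- The same for a point with values in a ring `R`, as a framed triple over `R`. -/
def ringPointTriple {R : Type u} [CommRing R] (p : Spec (CommRingCat.of R) ⟶ cyclicTriples k n) :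
    FramedTriple n R :=
  (pointTriple p).map (Scheme.ΓSpecIso (CommRingCat.of R)).hom.hom

/-- `π` exhibits the `k`-scheme `M` (with structure morphism `s`) as the quotient of the scheme of
cyclic framed triples by `GL_n`, i.e. `M` is the quotient sheaf for the Zariski topology: two
`T`-valued points have the same image in `M` if and only if they are conjugate under `GL_n(T)`,
and `π` has sections locally on `M`. -/
structure IsGLQuotient {M : Scheme.{u}} (s : M ⟶ Spec (CommRingCat.of k))
    (π : cyclicTriples k n ⟶ M) : Prop where
  comp_str : π ≫ s = cyclicTriplesStr k n
  orbits : ∀ (T : Scheme.{u}) (p q : T ⟶ cyclicTriples k n),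
    p ≫ cyclicTriplesStr k n = q ≫ cyclicTriplesStr k n →
      (p ≫ π = q ≫ π ↔ ∃ g : GL (Fin n) Γ(T, ⊤), pointTriple q = g • pointTriple p)
  locallySplit : ∀ x : M, ∃ (W : M.Opens) (_ : x ∈ W) (σ : W.toScheme ⟶ cyclicTriples k n),
    σ ≫ π = W.ι

/-- The ideal of the zero locus of `df`, as a section of `Ω[A⁄k]`: it is generated by the
contractions of `df` with all `A`-linear forms on `Ω[A⁄k]`. -/
def criticalIdealAlg (k A : Type*) [CommRing k] [CommRing A] [Algebra k A] (f : A) : Ideal A :=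
  Ideal.span (Set.range fun φ : (Ω[A⁄k] →ₗ[A] A) => φ (KaehlerDifferential.D k A f))

/-- The ideal of `df = 0` on an open subscheme `W` of a `k`-scheme `M`, for a function `f` on `M`. -/
def criticalIdeal {M : Scheme.{u}} (s : M ⟶ Spec (CommRingCat.of k)) (f : Γ(M, ⊤))
    (W : M.Opens) : Ideal Γ(M, W) :=
  letI : Algebra k Γ(M, W) :=
    ((Scheme.ΓSpecIso (CommRingCat.of k)).inv ≫ s.appLE ⊤ W le_top).hom.toAlgebra
  criticalIdealAlg k Γ(M, W) ((M.presheaf.map (homOfLE (le_top : W ≤ ⊤)).op).hom f)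

/-- `I` is the ideal sheaf of the critical locus `{df = 0}` of the function `f` on the `k`-scheme
`M` (meant for `M` smooth over `k`). -/
def IsCriticalIdealSheaf {M : Scheme.{u}} (s : M ⟶ Spec (CommRingCat.of k)) (f : Γ(M, ⊤))
    (I : M.IdealSheafData) : Prop :=
  ∀ W : M.affineOpens, I.ideal W = criticalIdeal s f W

/-- The ideal `J` of `R[x, y, z]` defines a closed subscheme of `𝔸³_R` that is finite and locally
free of rank `n` over `R`. -/
structure IsLengthIdeal (n : ℕ) {R : Type*} [CommRing R] (J : Ideal (MvPolynomial (Fin 3) R)) :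
    Prop where
  finite : Module.Finite R (MvPolynomial (Fin 3) R ⧸ J)
  projective : Module.Projective R (MvPolynomial (Fin 3) R ⧸ J)
  rank : ∀ x : PrimeSpectrum R, Module.rankAtStalk (MvPolynomial (Fin 3) R ⧸ J) x = n

/-- The `R`-valued points of a `k`-scheme `H`, for a `k`-algebra `R`. -/
def RingPoint {H : Scheme.{u}} (s : H ⟶ Spec (CommRingCat.of k)) (R : Type u) [CommRing R]
    [Algebra k R] : Type u :=
  {q : Spec (CommRingCat.of R) ⟶ H // q ≫ s = Spec.map (CommRingCat.ofHom (algebraMap k R))}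

/-- The functoriality of `R`-valued points in the `k`-algebra `R`. -/
def RingPoint.map {H : Scheme.{u}} {s : H ⟶ Spec (CommRingCat.of k)} {R R' : Type u} [CommRing R]
    [CommRing R'] [Algebra k R] [Algebra k R'] (φ : R →ₐ[k] R') (q : RingPoint s R) :
    RingPoint s R' :=
  ⟨Spec.map (CommRingCat.ofHom φ.toRingHom) ≫ q.1, by
    rw [Category.assoc, q.2, ← Spec.map_comp, ← CommRingCat.ofHom_comp]
    congr 2
    exact φ.comp_algebraMap⟩

/-- The `k`-scheme `H` is the Hilbert scheme of `n` points on `𝔸³`: an identification, natural in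
the `k`-algebra `R`, of the `R`-valued points of `H` with the closed subschemes of `𝔸³_R` that are
finite and locally free of rank `n` over `R`. -/
structure HilbertSchemeStructure (n : ℕ) {H : Scheme.{u}} (s : H ⟶ Spec (CommRingCat.of k)) where
  toIdeal : ∀ (R : Type u) [CommRing R] [Algebra k R],
    RingPoint s R ≃ {J : Ideal (MvPolynomial (Fin 3) R) // IsLengthIdeal n J}
  natural : ∀ (R R' : Type u) [CommRing R] [CommRing R'] [Algebra k R] [Algebra k R']
    (φ : R →ₐ[k] R') (q : RingPoint s R),
    (toIdeal R' (q.map φ)).1 = (toIdeal R q).1.map (MvPolynomial.map φ.toRingHom)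

/-- The framed triple `t` describes the quotient `R[x, y, z] ⧸ J` in some basis: the matrices are
multiplication by `x, y, z` and the vector is the class of `1`. -/
def Describes {R : Type*} [CommRing R] (t : FramedTriple n R)
    (J : Ideal (MvPolynomial (Fin 3) R)) : Prop :=
  ∃ φ : (MvPolynomial (Fin 3) R ⧸ J) ≃ₗ[R] (Fin n → R),
    φ 1 = t.v ∧ ∀ i m, φ (Ideal.Quotient.mk J (MvPolynomial.X i) * m) = t.A i *ᵥ φ m

/-- The function `Tr([A, B] C)` on the scheme of cyclic framed triples. -/
def cyclicPotential (k : Type u) [Field k] (n : ℕ) : Γ(cyclicTriples k n, ⊤) :=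
  (pointTriple (𝟙 (cyclicTriples k n))).potential

end HilbCrit

end

/-!
The quotient `U_n → M_n` is built from slices. A list `f` of `n` noncommutative words picks out the
open locus of `U_n` where the vectors `w(A, B, C) v`, for `w` in `f`, form a basis; these loci cover
`U_n`. Expressing a triple of that locus in this basis conjugates it to a triple for which the basis
is the standard one. So each orbit there meets the closed slice `N_f`, on which the words of `f`
give the standard basis, in exactly one point (`PointConj.slice_eq`, `exists_slice_pointConj`). The
slices therefore glue to a scheme, the transition maps being renormalizations from one basis to
another (`quotientGlueData`). A cyclic triple has trivial stabilizer, so local conjugations agree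
on overlaps and glue to a global one (`PointConj.of_cover`); this makes the glued scheme a quotient
in the required sense (`exists_isGLQuotient`).

The other assertions hold for any quotient `π : U_n → M`, because the local sections of `π` make
`M` locally a retract of an open subscheme of affine space (`IsGLQuotient.exists_chart`). Retracts
of smooth algebras are smooth. Moreover, for a retraction `r` of algebras with section `i`, the
critical ideal of `a` is the extension along `r` of the critical ideal of `i a`
(`criticalIdealAlg_of_retract`): when differentials of the source are projective, the critical ideal
of `g a`, for an algebra map `g`, lies in the extension of the critical ideal of `a`, and this is
applied to `i` and to `r`, whose composite is the identity. On affine space the critical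
ideal is spanned by the partial derivatives, and those of `Tr([A, B] C)` are, up to sign, the
entries of the three commutators (`span_pderiv_potential`). Over a chart the critical ideal of `f_n`
is hence generated by the entries of the commutators of a local section, and the preimage of the
critical locus in `U_n` is the locus of commuting triples
(`IsGLQuotient.exists_comp_subschemeι_iff_pairwiseCommute`). Here `f_n` exists because the
potential is invariant under conjugation and descends along the local sections.

A commuting cyclic triple over `R` defines a surjection `R[x, y, z] → Rⁿ`, `P ↦ P(A, B, C) v`,
whose kernel is an ideal `J` with quotient free of rank `n` (`exists_describes`). Two commuting
triples have the same ideal exactly if they are conjugate (`Describes.exists_smul_eq`), and an ideal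
of length `n` arises in this way locally on `Spec R`, after choosing a basis of its quotient
(`IsLengthIdeal.exists_describes`). Since ideals and points of a scheme are both determined by
compatible local data, the local correspondence between triples up to conjugation and ideals glues
to a natural bijection (`IsCommutingQuotient.exists_hilbertSchemeStructure`).
-/

noncomputable section

namespace HilbCrit

/-! ### Framed triples over a ring -/

namespace FramedTriple

variable {n : ℕ} {S S' S'' : Type*}

@[simp] lemma map_A [CommRing S] [CommRing S'] (φ : S →+* S') (t : FramedTriple n S) (i) :
    (t.map φ).A i = (t.A i).map φ := rfl

@[simp] lemma map_v [CommRing S] [CommRing S'] (φ : S →+* S') (t : FramedTriple n S) (j) :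
    (t.map φ).v j = φ (t.v j) := rfl

lemma map_map [CommRing S] [CommRing S'] [CommRing S''] (φ : S →+* S') (ψ : S' →+* S'')
    (t : FramedTriple n S) : (t.map φ).map ψ = t.map (ψ.comp φ) := rfl

lemma smul_A [CommRing S] (g : GL (Fin n) S) (t : FramedTriple n S) (i) :
    (g • t).A i = (g : Matrix (Fin n) (Fin n) S) * t.A i * (↑g⁻¹ : Matrix (Fin n) (Fin n) S) := rfl

lemma smul_v [CommRing S] (g : GL (Fin n) S) (t : FramedTriple n S) :
    (g • t).v = (g : Matrix (Fin n) (Fin n) S) *ᵥ t.v := rfl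

instance [CommRing S] : MulAction (GL (Fin n) S) (FramedTriple n S) where
  one_smul t := by
    ext <;> simp [smul_A, smul_v]
  mul_smul g h t := by
    ext i a b
    · simp [smul_A, Matrix.mul_assoc]
    · simp [smul_v]

lemma map_smul [CommRing S] [CommRing S'] (φ : S →+* S') (g : GL (Fin n) S)
    (t : FramedTriple n S) :
    (g • t).map φ = GeneralLinearGroup.map φ g • t.map φ := by
  ext i a b
  · simp only [map_A, smul_A, Matrix.map_mul]
    rfl
  · simp only [map_v, smul_v, RingHom.map_mulVec]
    rfl

lemma smul_A_mul [CommRing S] (g : GL (Fin n) S) (t : FramedTriple n S) (i) :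
    (g • t).A i * (g : Matrix (Fin n) (Fin n) S) = (g : Matrix (Fin n) (Fin n) S) * t.A i := by
  rw [smul_A, Matrix.mul_assoc, ← Units.val_mul, inv_mul_cancel, Units.val_one, Matrix.mul_one]

lemma word_smul [CommRing S] (g : GL (Fin n) S) (t : FramedTriple n S) (w : List (Fin 3)) :
    (g • t).word w = (g : Matrix (Fin n) (Fin n) S) *ᵥ t.word w := by
  induction w with
  | nil => rfl
  | cons i w ih =>
    simp only [word, ih, Matrix.mulVec_mulVec, smul_A_mul]

/-- The matrix whose columns are the `n` vectors obtained by applying `n` given words to `v`. -/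
def wordMatrix [CommRing S] (t : FramedTriple n S) (f : Fin n → List (Fin 3)) :
    Matrix (Fin n) (Fin n) S :=
  Matrix.of fun i j => t.word (f j) i

lemma det_wordMatrix [CommRing S] (t : FramedTriple n S) (f : Fin n → List (Fin 3)) :
    (t.wordMatrix f).det = t.wordDet f := rfl

lemma mul_wordMatrix [CommRing S] (t : FramedTriple n S) (f : Fin n → List (Fin 3))
    (X : Matrix (Fin n) (Fin n) S) :
    X * t.wordMatrix f = Matrix.of fun i j => (X *ᵥ t.word (f j)) i := rfl

lemma wordMatrix_map [CommRing S] [CommRing S'] (φ : S →+* S') (t : FramedTriple n S)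
    (f : Fin n → List (Fin 3)) : (t.map φ).wordMatrix f = (t.wordMatrix f).map φ := by
  ext i j
  simp [wordMatrix, word_map]

lemma wordMatrix_smul [CommRing S] (g : GL (Fin n) S) (t : FramedTriple n S)
    (f : Fin n → List (Fin 3)) :
    (g • t).wordMatrix f = (g : Matrix (Fin n) (Fin n) S) * t.wordMatrix f := by
  simp only [mul_wordMatrix, ← word_smul]
  rfl

lemma wordDet_smul [CommRing S] (g : GL (Fin n) S) (t : FramedTriple n S)
    (f : Fin n → List (Fin 3)) :
    (g • t).wordDet f = (g : Matrix (Fin n) (Fin n) S).det * t.wordDet f := by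
  rw [← det_wordMatrix, wordMatrix_smul, Matrix.det_mul, det_wordMatrix]

/-- The commutator of two of the matrices. -/
def comm [CommRing S] (t : FramedTriple n S) (i j : Fin 3) : Matrix (Fin n) (Fin n) S :=
  t.A i * t.A j - t.A j * t.A i

lemma comm_map [CommRing S] [CommRing S'] (φ : S →+* S') (t : FramedTriple n S) (i j) :
    (t.map φ).comm i j = (t.comm i j).map φ := by
  simp [comm, Matrix.map_mul, Matrix.map_sub]

lemma pairwiseCommute_iff_comm [CommRing S] (t : FramedTriple n S) :
    t.PairwiseCommute ↔ ∀ i j, t.comm i j = 0 := by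
  simp [PairwiseCommute, comm, sub_eq_zero]

lemma PairwiseCommute.map [CommRing S] [CommRing S'] {t : FramedTriple n S}
    (h : t.PairwiseCommute) (φ : S →+* S') : (t.map φ).PairwiseCommute := by
  intro i j
  simp only [map_A, ← Matrix.map_mul, h i j]

lemma PairwiseCommute.smul [CommRing S] {t : FramedTriple n S}
    (h : t.PairwiseCommute) (g : GL (Fin n) S) : (g • t).PairwiseCommute := by
  intro i j
  have key : ∀ i j, (g • t).A i * (g • t).A j =
      (g : Matrix (Fin n) (Fin n) S) * (t.A i * t.A j) * (↑g⁻¹ : Matrix (Fin n) (Fin n) S) := by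
    intro i j
    rw [smul_A g t j, ← Matrix.mul_assoc, ← Matrix.mul_assoc, smul_A_mul]
    simp only [Matrix.mul_assoc]
  rw [key, key, h i j]

lemma pairwiseCommute_smul_iff [CommRing S] (t : FramedTriple n S) (g : GL (Fin n) S) :
    (g • t).PairwiseCommute ↔ t.PairwiseCommute :=
  ⟨fun h => by simpa using h.smul g⁻¹, fun h => h.smul g⟩

/-- The ideal generated by the entries of the commutators: it cuts out the locus where the three
matrices commute. -/
def commIdeal [CommRing S] (t : FramedTriple n S) : Ideal S :=
  Ideal.span (Set.range fun c : Fin 3 × Fin 3 × Fin n × Fin n => t.comm c.1 c.2.1 c.2.2.1 c.2.2.2)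

lemma commIdeal_map [CommRing S] [CommRing S'] (φ : S →+* S') (t : FramedTriple n S) :
    (t.map φ).commIdeal = t.commIdeal.map φ := by
  rw [commIdeal, commIdeal, Ideal.map_span, ← Set.range_comp]
  simp only [comm_map]
  rfl

lemma commIdeal_eq_bot_iff [CommRing S] (t : FramedTriple n S) :
    t.commIdeal = ⊥ ↔ t.PairwiseCommute := by
  rw [commIdeal, Ideal.span_eq_bot, pairwiseCommute_iff_comm]
  constructor
  · intro h i j
    ext a b
    exact h _ ⟨(i, j, a, b), rfl⟩
  · rintro h _ ⟨c, rfl⟩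
    simp [h]

lemma commIdeal_le_ker_iff [CommRing S] [CommRing S'] (φ : S →+* S') (t : FramedTriple n S) :
    t.commIdeal ≤ RingHom.ker φ ↔ (t.map φ).PairwiseCommute := by
  rw [← commIdeal_eq_bot_iff, commIdeal_map, Ideal.map_eq_bot_iff_le_ker]

lemma potential_map [CommRing S] [CommRing S'] (φ : S →+* S') (t : FramedTriple n S) :
    (t.map φ).potential = φ t.potential := by
  have := t.comm_map φ 0 1
  simp only [comm] at this
  rw [potential, this, map_A, ← Matrix.map_mul, potential]
  exact (AddMonoidHom.map_trace φ.toAddMonoidHom _).symm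

lemma potential_smul [CommRing S] (g : GL (Fin n) S) (t : FramedTriple n S) :
    (g • t).potential = t.potential := by
  have h1 : ((g • t).A 0 * (g • t).A 1 - (g • t).A 1 * (g • t).A 0) * (g • t).A 2 =
      (g : Matrix (Fin n) (Fin n) S) * ((t.A 0 * t.A 1 - t.A 1 * t.A 0) * t.A 2) *
        (↑g⁻¹ : Matrix (Fin n) (Fin n) S) := by
    have key : ∀ X Y : Matrix (Fin n) (Fin n) S,
        ((g : Matrix (Fin n) (Fin n) S) * X * (↑g⁻¹ : Matrix (Fin n) (Fin n) S)) *
          ((g : Matrix (Fin n) (Fin n) S) * Y * (↑g⁻¹ : Matrix (Fin n) (Fin n) S)) =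
        (g : Matrix (Fin n) (Fin n) S) * (X * Y) * (↑g⁻¹ : Matrix (Fin n) (Fin n) S) := by
      intro X Y
      calc _ = (g : Matrix (Fin n) (Fin n) S) * X * ((↑g⁻¹ : Matrix (Fin n) (Fin n) S) *
              (g : Matrix (Fin n) (Fin n) S)) * Y * (↑g⁻¹ : Matrix (Fin n) (Fin n) S) := by
            simp only [Matrix.mul_assoc]
        _ = _ := by
            rw [← Units.val_mul, inv_mul_cancel, Units.val_one, Matrix.mul_one]
            simp only [Matrix.mul_assoc]
    simp only [smul_A, key, ← Matrix.mul_sub, ← Matrix.sub_mul]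
  rw [potential, h1, Matrix.trace_mul_cycle, ← Units.val_mul, inv_mul_cancel, Units.val_one,
    Matrix.one_mul, potential]

/-- A matrix is determined by its action on the vectors `w(A, B, C) v` where one of the word
determinants is invertible. -/
lemma matrix_ext_of_isUnit [CommRing S] {t : FramedTriple n S} {f : Fin n → List (Fin 3)}
    (hf : IsUnit (t.wordDet f)) {X Y : Matrix (Fin n) (Fin n) S}
    (h : ∀ w, X *ᵥ t.word w = Y *ᵥ t.word w) : X = Y := by
  have h1 : X * t.wordMatrix f = Y * t.wordMatrix f := by
    simp only [mul_wordMatrix, h]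
  rw [← det_wordMatrix] at hf
  calc X = X * t.wordMatrix f * (t.wordMatrix f)⁻¹ := by
        rw [Matrix.mul_assoc, Matrix.mul_nonsing_inv _ hf, Matrix.mul_one]
    _ = Y := by rw [h1, Matrix.mul_assoc, Matrix.mul_nonsing_inv _ hf, Matrix.mul_one]

/-- The ring-theoretic form of cyclicity: the word determinants generate the unit ideal. -/
def UnitWordDets [CommRing S] (t : FramedTriple n S) : Prop :=
  Ideal.span (Set.range t.wordDet) = ⊤

lemma UnitWordDets.map [CommRing S] [CommRing S'] {t : FramedTriple n S}
    (h : t.UnitWordDets) (φ : S →+* S') : (t.map φ).UnitWordDets := by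
  have : (t.map φ).wordDet = φ ∘ t.wordDet := by
    funext f
    exact wordDet_map φ t f
  rw [UnitWordDets, this, Set.range_comp, ← Ideal.map_span, h, Ideal.map_top]

lemma coords_map [CommRing S] [CommRing S'] (φ : S →+* S') (t : FramedTriple n S) (c) :
    (t.map φ).coords c = φ (t.coords c) := by
  rcases c with c | c <;> rfl

end FramedTriple

/-! ### The generic triple and the derivatives of the potential -/

section generic

variable {k : Type u} [Field k] {n : ℕ} {R : Type*} [CommRing R]

lemma generic_coords (c : Coord n) : (generic k n).coords c = MvPolynomial.X c := by
  rcases c with ⟨i, a, b⟩ | j <;> rfl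

lemma FramedTriple.ext_coords {S : Type*} {t t' : FramedTriple n S}
    (h : ∀ c, t.coords c = t'.coords c) : t = t' := by
  ext i a b
  · exact h (Sum.inl (i, a, b))
  · exact h (Sum.inr i)

lemma generic_map_coords (φ : MvPolynomial (Coord n) k →+* R) (c : Coord n) :
    ((generic k n).map φ).coords c = φ (MvPolynomial.X c) := by
  rw [FramedTriple.coords_map, generic_coords]

lemma generic_map_eval₂Hom (ρ : k →+* R) (t : FramedTriple n R) :
    (generic k n).map (MvPolynomial.eval₂Hom ρ t.coords) = t :=
  FramedTriple.ext_coords fun c => by simp [generic_map_coords]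

lemma generic_map_aeval [Algebra k R] (t : FramedTriple n R) :
    (generic k n).map (MvPolynomial.aeval (R := k) t.coords).toRingHom = t :=
  FramedTriple.ext_coords fun c => by simp [generic_map_coords]

/-- The matrix of derivatives of a product. -/
lemma map_derivation_mul {A : Type*} [CommRing A] [Algebra A R] {m : Type*} [Fintype m]
    (D : Derivation A R R) (X Y : Matrix m m R) :
    (X * Y).map D = X.map D * Y + X * Y.map D := by
  ext a b
  simp only [Matrix.map_apply, Matrix.mul_apply, Matrix.add_apply, map_sum, Derivation.leibniz,
    smul_eq_mul, Finset.sum_add_distrib]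
  rw [add_comm]
  congr 1
  exact Finset.sum_congr rfl fun c _ => mul_comm _ _

lemma generic_A_map_pderiv (l i : Fin 3) (a b : Fin n) :
    ((generic k n).A i).map (MvPolynomial.pderiv (Sum.inl (l, a, b))) =
      if i = l then Matrix.single a b 1 else 0 := by
  ext x y
  by_cases h : i = l
  · subst h
    simp [generic, MvPolynomial.pderiv_X, Pi.single_apply, Matrix.single_apply, eq_comm]
  · simp [generic, MvPolynomial.pderiv_X, h]

lemma generic_A_map_pderiv_inr (i : Fin 3) (j : Fin n) :
    ((generic k n).A i).map (MvPolynomial.pderiv (Sum.inr j)) = 0 := by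
  ext x y
  simp [generic, MvPolynomial.pderiv_X]

/-- The derivative of `Tr([A, B] C)` along a derivation. -/
lemma derivation_potential {A : Type*} [CommRing A] [Algebra A R] (D : Derivation A R R)
    (t : FramedTriple n R) :
    D t.potential = ((t.A 0).map D * t.comm 1 2).trace + ((t.A 1).map D * t.comm 2 0).trace +
      ((t.A 2).map D * t.comm 0 1).trace := by
  have h : D t.potential =
      (((t.A 0 * t.A 1 - t.A 1 * t.A 0) * t.A 2).map D).trace := by
    simp [FramedTriple.potential, Matrix.trace, map_sum]
  have hsub : ∀ X Y : Matrix (Fin n) (Fin n) R, (X - Y).map D = X.map D - Y.map D := by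
    intro X Y
    ext a b
    simp
  rw [h, map_derivation_mul, hsub, map_derivation_mul, map_derivation_mul]
  generalize (t.A 0).map D = d0
  generalize (t.A 1).map D = d1
  generalize (t.A 2).map D = d2
  have h1 : (t.A 0 * d1 * t.A 2).trace = (d1 * (t.A 2 * t.A 0)).trace := by
    rw [Matrix.mul_assoc, Matrix.trace_mul_comm, Matrix.mul_assoc]
  have h2 : (t.A 1 * d0 * t.A 2).trace = (d0 * (t.A 2 * t.A 1)).trace := by
    rw [Matrix.mul_assoc, Matrix.trace_mul_comm, Matrix.mul_assoc]
  simp only [FramedTriple.comm, Matrix.add_mul, Matrix.sub_mul, Matrix.mul_sub, Matrix.trace_add,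
    Matrix.trace_sub, h1, h2, Matrix.mul_assoc d0, Matrix.mul_assoc d1,
    Matrix.trace_mul_comm _ d2]
  ring

/-- The partial derivatives of `Tr([A, B] C)` in the matrix entries are the entries of the three
commutators. -/
lemma pderiv_potential (l : Fin 3) (a b : Fin n) :
    MvPolynomial.pderiv (Sum.inl (l, a, b)) (generic k n).potential =
      (generic k n).comm (l + 1) (l + 2) b a := by
  rw [derivation_potential]
  simp only [generic_A_map_pderiv]
  fin_cases l <;> simp [Matrix.trace_single_mul]

lemma pderiv_potential_inr (j : Fin n) :
    MvPolynomial.pderiv (Sum.inr j) (generic k n).potential = 0 := by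
  rw [derivation_potential]
  simp [generic_A_map_pderiv_inr]

/-- The partial derivatives of `Tr([A, B] C)` generate the commutator ideal. -/
lemma span_pderiv_potential :
    Ideal.span (Set.range fun c => MvPolynomial.pderiv c (generic k n).potential) =
      (generic k n).commIdeal := by
  apply le_antisymm
  · rw [Ideal.span_le]
    rintro _ ⟨⟨l, a, b⟩ | j, rfl⟩
    · exact Ideal.subset_span ⟨(l + 1, l + 2, b, a), (pderiv_potential l a b).symm⟩
    · simp [pderiv_potential_inr]
  · rw [FramedTriple.commIdeal, Ideal.span_le]
    rintro _ ⟨⟨i, j, a, b⟩, rfl⟩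
    have h : ∀ l : Fin 3, (generic k n).comm (l + 1) (l + 2) a b ∈
        Ideal.span (Set.range fun c => MvPolynomial.pderiv c (generic k n).potential) :=
      fun l => Ideal.subset_span ⟨Sum.inl (l, b, a), pderiv_potential l b a⟩
    have hneg : ∀ i j : Fin 3, (generic k n).comm i j a b = -(generic k n).comm j i a b := by
      intro i j
      simp [FramedTriple.comm]
    have hself : ∀ i : Fin 3, (generic k n).comm i i a b = 0 := by
      intro i
      simp [FramedTriple.comm]
    have h0 : (generic k n).comm 1 2 a b ∈ _ := h 0
    have h1 : (generic k n).comm 2 0 a b ∈ _ := h 1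
    have h2 : (generic k n).comm 0 1 a b ∈ _ := h 2
    simp only [SetLike.mem_coe]
    fin_cases i <;> fin_cases j <;> dsimp only [Fin.zero_eta, Fin.mk_one, Fin.reduceFinMk]
    · rw [hself]; exact zero_mem _
    · exact h2
    · rw [hneg]; exact neg_mem h1
    · rw [hneg]; exact neg_mem h2
    · rw [hself]; exact zero_mem _
    · exact h0
    · exact h1
    · rw [hneg]; exact neg_mem h0
    · rw [hself]; exact zero_mem _

/-- All partial derivatives of `Tr([A, B] C)` vanish exactly at the commuting triples. -/
lemma pderiv_potential_eq_zero_iff [Algebra k R] (t : FramedTriple n R) :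
    (∀ c : Coord n, MvPolynomial.aeval t.coords
      (MvPolynomial.pderiv c (generic k n).potential) = 0) ↔ t.PairwiseCommute := by
  conv_rhs => rw [← generic_map_aeval (k := k) t, ← FramedTriple.commIdeal_le_ker_iff,
    ← span_pderiv_potential, Ideal.span_le, Set.range_subset_iff]
  rfl

end generic

end HilbCrit

namespace HilbCrit

/-! ### Critical ideals of functions on algebras -/

section critical

variable {k A B : Type*} [CommRing k] [CommRing A] [CommRing B] [Algebra k A] [Algebra k B]

/-- A projective module has enough linear forms: the value of any linear map at `x` lies in the
ideal generated by the values of the linear forms at `x`. -/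
lemma linearMap_apply_mem_map_span [Algebra A B] {M : Type*} [AddCommGroup M] [Module A M]
    [Module.Projective A M] (x : M) (χ : M →ₗ[A] B) :
    χ x ∈ (Ideal.span (Set.range fun φ : M →ₗ[A] A => φ x)).map (algebraMap A B) := by
  obtain ⟨s, hs⟩ := Module.projective_def'.1 (inferInstance : Module.Projective A M)
  have hx : x = (s x).sum fun m a => a • m := by
    conv_lhs => rw [← LinearMap.id_apply (R := A) x, ← hs]
    rw [LinearMap.comp_apply, Finsupp.linearCombination_apply]
    rfl
  have : χ x = (s x).sum fun m a => algebraMap A B a * χ m := by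
    conv_lhs => rw [hx]
    simp only [Finsupp.sum, map_sum, map_smul, Algebra.smul_def]
  rw [this]
  refine Ideal.sum_mem _ fun m _ => Ideal.mul_mem_right _ _ (Ideal.mem_map_of_mem _ ?_)
  exact Ideal.subset_span ⟨(Finsupp.lapply m).comp s, rfl⟩

/-- A linear form on `Ω[B⁄k]` pulls back to a `B`-valued one on `Ω[A⁄k]`, which is a combination of
`A`-valued linear forms because `Ω[A⁄k]` is projective. -/
lemma criticalIdealAlg_apply_le (g : A →ₐ[k] B) [Module.Projective A (Ω[A⁄k])] (f : A) :
    criticalIdealAlg k B (g f) ≤ (criticalIdealAlg k A f).map g.toRingHom := by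
  let _ : Algebra A B := g.toRingHom.toAlgebra
  have : IsScalarTower k A B := IsScalarTower.of_algebraMap_eq fun x => (g.commutes x).symm
  rw [criticalIdealAlg, Ideal.span_le]
  rintro _ ⟨φ, rfl⟩
  have := linearMap_apply_mem_map_span (B := B) (KaehlerDifferential.D k A f)
    ((φ.restrictScalars A).comp (KaehlerDifferential.map k k A B))
  rw [LinearMap.comp_apply, LinearMap.restrictScalars_apply, KaehlerDifferential.map_D] at this
  exact this

/-- Critical ideals are compatible with formally étale extensions. -/
lemma criticalIdealAlg_algebraMap [Algebra A B] [IsScalarTower k A B]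
    [Algebra.FormallyEtale A B] [Module.Projective A (Ω[A⁄k])] (f : A) :
    criticalIdealAlg k B (algebraMap A B f) = (criticalIdealAlg k A f).map (algebraMap A B) := by
  apply le_antisymm (criticalIdealAlg_apply_le (IsScalarTower.toAlgHom k A B) f)
  rw [criticalIdealAlg, Ideal.map_le_iff_le_comap, Ideal.span_le]
  rintro _ ⟨φ, rfl⟩
  let e := KaehlerDifferential.tensorKaehlerEquivOfFormallyEtale k A B
  let ψ : Ω[B⁄k] →ₗ[B] B :=
    (TensorProduct.AlgebraTensorModule.lift
      ((LinearMap.toSpanSingleton B (Ω[A⁄k] →ₗ[A] B)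
        ((Algebra.linearMap A B).comp φ)))) ∘ₗ e.symm.toLinearMap
  refine Ideal.subset_span ⟨ψ, ?_⟩
  have he : e.symm (KaehlerDifferential.D k B (algebraMap A B f)) =
      1 ⊗ₜ[A] KaehlerDifferential.D k A f := by
    rw [LinearEquiv.symm_apply_eq]
    simp [e]
  simp [ψ, he]

/-- Critical ideals are compatible with retracts. -/
lemma criticalIdealAlg_retract (i : A →ₐ[k] B) (r : B →ₐ[k] A) (hri : ∀ a, r (i a) = a)
    [Module.Projective A (Ω[A⁄k])] [Module.Projective B (Ω[B⁄k])] (f : A) :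
    criticalIdealAlg k A f = (criticalIdealAlg k B (i f)).map r.toRingHom := by
  apply le_antisymm
  · conv_lhs => rw [← hri f]
    exact criticalIdealAlg_apply_le r (i f)
  · refine (Ideal.map_mono (criticalIdealAlg_apply_le i f)).trans ?_
    rw [Ideal.map_map]
    have : r.toRingHom.comp i.toRingHom = RingHom.id A := RingHom.ext hri
    rw [this, Ideal.map_id]

/-- A retract of a formally smooth algebra is formally smooth. -/
lemma formallySmooth_of_retract (i : A →ₐ[k] B) (r : B →ₐ[k] A) (hri : ∀ a, r (i a) = a)
    [Algebra.FormallySmooth k B] : Algebra.FormallySmooth k A := by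
  refine Algebra.FormallySmooth.of_comp_surjective fun C _ _ I hI g => ?_
  obtain ⟨h, hh⟩ := Algebra.FormallySmooth.comp_surjective k B I hI (g.comp r)
  refine ⟨h.comp i, ?_⟩
  ext a
  have := DFunLike.congr_fun hh (i a)
  simpa [hri] using this

/-- A retract of a smooth algebra over a field is smooth. -/
lemma smooth_of_retract {k A B : Type*} [Field k] [CommRing A] [CommRing B] [Algebra k A]
    [Algebra k B] (i : A →ₐ[k] B) (r : B →ₐ[k] A) (hri : ∀ a, r (i a) = a)
    [Algebra.Smooth k B] : Algebra.Smooth k A where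
  formallySmooth := formallySmooth_of_retract i r hri
  finitePresentation := by
    have : Algebra.FiniteType k A :=
      Algebra.FiniteType.of_surjective r fun a => ⟨i a, hri a⟩
    exact Algebra.FinitePresentation.of_finiteType.1 this

/-- The critical ideal of a polynomial is generated by its partial derivatives. -/
lemma criticalIdealAlg_mvPolynomial {σ : Type*} [Finite σ] (f : MvPolynomial σ k) :
    criticalIdealAlg k (MvPolynomial σ k) f =
      Ideal.span (Set.range fun c => MvPolynomial.pderiv c f) := by
  have := Fintype.ofFinite σ
  apply le_antisymm
  · rw [criticalIdealAlg, Ideal.span_le]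
    rintro _ ⟨φ, rfl⟩
    have := (KaehlerDifferential.mvPolynomialBasis k σ).sum_repr (KaehlerDifferential.D k _ f)
    change φ (KaehlerDifferential.D k _ f) ∈ _
    rw [← this, map_sum]
    refine Ideal.sum_mem _ fun c _ => ?_
    rw [map_smul, smul_eq_mul]
    refine Ideal.mul_mem_right _ _ (Ideal.subset_span ⟨c, ?_⟩)
    simp [KaehlerDifferential.mvPolynomialBasis_repr_apply]
  · rw [Ideal.span_le]
    rintro _ ⟨c, rfl⟩
    refine Ideal.subset_span ⟨(KaehlerDifferential.mvPolynomialBasis k σ).coord c, ?_⟩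
    simp [KaehlerDifferential.mvPolynomialBasis_repr_apply]

/-- The function `Tr([A, B] C)` on a space that is étale over the affine space of framed triples
has the commutator ideal as critical ideal. -/
lemma criticalIdealAlg_potential {k : Type u} [Field k] {n : ℕ} {B : Type*} [CommRing B]
    [Algebra k B] [Algebra (MvPolynomial (Coord n) k) B]
    [IsScalarTower k (MvPolynomial (Coord n) k) B]
    [Algebra.FormallyEtale (MvPolynomial (Coord n) k) B] :
    criticalIdealAlg k B (algebraMap _ B (generic k n).potential) =
      ((generic k n).map (algebraMap (MvPolynomial (Coord n) k) B)).commIdeal := by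
  rw [criticalIdealAlg_algebraMap, criticalIdealAlg_mvPolynomial, span_pderiv_potential,
    FramedTriple.commIdeal_map]

/-- Suppose that `A` is a retract of an algebra `B` that is étale over the affine space of framed
triples. Then `A` is smooth, and the critical ideal of a function `f` on `A` that becomes
`Tr([A, B] C)` on `B` is the commutator ideal of the triple over `A` given by the retraction. -/
lemma criticalIdealAlg_of_retract {k : Type u} [Field k] {n : ℕ} {A B : Type u} [CommRing A]
    [CommRing B] (ρ : k →+* A) (ε : MvPolynomial (Coord n) k →+* B) (hε : ε.Etale) (i : A →+* B)
    (r : B →+* A) (hri : r.comp i = RingHom.id A) (hi : i.comp ρ = ε.comp MvPolynomial.C) :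
    ρ.Smooth ∧ ∀ f : A, i f = ε (generic k n).potential →
      @criticalIdealAlg k A _ _ ρ.toAlgebra f = ((generic k n).map (r.comp ε)).commIdeal := by
  let _ : Algebra k A := ρ.toAlgebra
  let _ : Algebra (MvPolynomial (Coord n) k) B := ε.toAlgebra
  let _ : Algebra k B := (ε.comp MvPolynomial.C).toAlgebra
  have : IsScalarTower k (MvPolynomial (Coord n) k) B := IsScalarTower.of_algebraMap_eq fun _ => rfl
  have : Algebra.Etale (MvPolynomial (Coord n) k) B := hε
  have : Algebra.Smooth k (MvPolynomial (Coord n) k) := ⟨inferInstance, inferInstance⟩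
  have : Algebra.Smooth k B := Algebra.Smooth.comp k (MvPolynomial (Coord n) k) B
  let i' : A →ₐ[k] B := ⟨i, RingHom.congr_fun hi⟩
  let r' : B →ₐ[k] A := ⟨r, fun c => by
    have h1 := RingHom.congr_fun hi c
    have h2 := RingHom.congr_fun hri (ρ c)
    simp only [RingHom.comp_apply] at h1 h2
    change r (ε (MvPolynomial.C c)) = ρ c
    rw [← h1, h2, RingHom.id_apply]⟩
  have hri' : ∀ a, r' (i' a) = a := RingHom.congr_fun hri
  have hA : Algebra.Smooth k A := smooth_of_retract i' r' hri'
  refine ⟨hA, fun f hf => ?_⟩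
  have h1 : i' f = algebraMap (MvPolynomial (Coord n) k) B (generic k n).potential := hf
  rw [criticalIdealAlg_retract i' r' hri' f, h1, criticalIdealAlg_potential,
    ← FramedTriple.commIdeal_map, FramedTriple.map_map]
  rfl

/-- Critical ideals are compatible with étale extensions of smooth algebras. -/
lemma criticalIdealAlg_map_of_etale {k A B : Type*} [CommRing k] [CommRing A] [CommRing B]
    (ρ : k →+* A) (hρ : ρ.Smooth) (ε : A →+* B) (hε : ε.Etale) (σ : k →+* B)
    (h : ε.comp ρ = σ) (f : A) :
    (@criticalIdealAlg k A _ _ ρ.toAlgebra f).map ε =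
      @criticalIdealAlg k B _ _ σ.toAlgebra (ε f) := by
  let _ : Algebra k A := ρ.toAlgebra
  let _ : Algebra A B := ε.toAlgebra
  let _ : Algebra k B := σ.toAlgebra
  have : IsScalarTower k A B := IsScalarTower.of_algebraMap_eq fun x => (RingHom.congr_fun h x).symm
  have : Algebra.Etale A B := hε
  have : Algebra.Smooth k A := hρ
  exact (criticalIdealAlg_algebraMap f).symm

end critical

end HilbCrit

namespace HilbCrit

/-! ### Points of the scheme of cyclic framed triples -/

section specHom

variable {T T' : Scheme.{u}} {R : CommRingCat.{u}}

/-- The ring homomorphism `R → Γ(T, ⊤)` of a morphism `T ⟶ Spec R`. -/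
def specHom (f : T ⟶ Spec R) : R →+* Γ(T, ⊤) := ((Scheme.ΓSpecIso R).inv ≫ f.appTop).hom

lemma specHom_comp (h : T' ⟶ T) (f : T ⟶ Spec R) :
    specHom (h ≫ f) = h.appTop.hom.comp (specHom f) := by
  rw [specHom, specHom, Scheme.Hom.comp_appTop, ← Category.assoc, CommRingCat.hom_comp]

lemma specHom_comp_SpecMap {R' : CommRingCat.{u}} (f : T ⟶ Spec R) (φ : R' ⟶ R) :
    specHom (f ≫ Spec.map φ) = (specHom f).comp φ.hom := by
  rw [specHom, Scheme.Hom.comp_appTop, ← Scheme.ΓSpecIso_inv_naturality_assoc]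
  rfl

lemma specHom_ext {f g : T ⟶ Spec R} (h : specHom f = specHom g) : f = g := by
  apply ext_of_isAffine
  rw [← cancel_epi (Scheme.ΓSpecIso R).inv]
  exact CommRingCat.hom_ext h

lemma specHom_toSpecΓ (φ : R ⟶ Γ(T, ⊤)) : specHom (T.toSpecΓ ≫ Spec.map φ) = φ.hom := by
  rw [specHom_comp_SpecMap]
  simp [specHom, Scheme.toSpecΓ_appTop]

lemma eq_toSpecΓ_specHom (f : T ⟶ Spec R) :
    f = T.toSpecΓ ≫ Spec.map (CommRingCat.ofHom (specHom f)) :=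
  specHom_ext (by rw [specHom_toSpecΓ]; rfl)

lemma preimage_basicOpen_eq (f : T ⟶ Spec R) (r : R) :
    f ⁻¹ᵁ PrimeSpectrum.basicOpen r = T.basicOpen (specHom f r) := by
  conv_lhs => rw [eq_toSpecΓ_specHom f]
  rw [← Scheme.toSpecΓ_preimage_basicOpen]
  rfl

end specHom

variable {k : Type u} [Field k] {n : ℕ} {T T' : Scheme.{u}}

lemma mem_cyclicLocus_iff (x : PrimeSpectrum (MvPolynomial (Coord n) k)) :
    x ∈ cyclicLocus k n ↔ ∃ f, (generic k n).wordDet f ∉ x.asIdeal := by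
  change ((generic k n).map (algebraMap _ x.asIdeal.ResidueField)).IsCyclic ↔ _
  simp [FramedTriple.isCyclic_iff, FramedTriple.wordDet_map]

lemma pointTriple_def (p : T ⟶ cyclicTriples k n) :
    pointTriple p = (generic k n).map (specHom (p ≫ (cyclicLocus k n).ι)) := rfl

lemma pointTriple_comp (h : T' ⟶ T) (p : T ⟶ cyclicTriples k n) :
    pointTriple (h ≫ p) = (pointTriple p).map h.appTop.hom := by
  rw [pointTriple_def, Category.assoc, specHom_comp]
  rfl

/-- A morphism to the scheme of cyclic framed triples is determined by its structure morphism and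
its triple. -/
lemma point_ext {p q : T ⟶ cyclicTriples k n}
    (hs : p ≫ cyclicTriplesStr k n = q ≫ cyclicTriplesStr k n)
    (ht : pointTriple p = pointTriple q) : p = q := by
  rw [← cancel_mono (cyclicLocus k n).ι]
  apply specHom_ext
  apply MvPolynomial.ringHom_ext
  · intro c
    have := congrArg specHom hs
    rw [cyclicTriplesStr, ← Category.assoc, ← Category.assoc, specHom_comp_SpecMap,
      specHom_comp_SpecMap] at this
    exact RingHom.congr_fun this c
  · intro c
    rw [← generic_map_coords, ← generic_map_coords]
    exact congrArg (fun t => FramedTriple.coords t c) ht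

lemma preimage_wordDet (p : T ⟶ cyclicTriples k n) (f : Fin n → List (Fin 3)) :
    (p ≫ (cyclicLocus k n).ι) ⁻¹ᵁ PrimeSpectrum.basicOpen ((generic k n).wordDet f) =
      T.basicOpen ((pointTriple p).wordDet f) := by
  rw [preimage_basicOpen_eq, pointTriple_def, FramedTriple.wordDet_map]

/-- Locally on the source, one of the word determinants of a point is invertible. -/
lemma exists_mem_basicOpen_wordDet (p : T ⟶ cyclicTriples k n) (x : T) :
    ∃ f, x ∈ T.basicOpen ((pointTriple p).wordDet f) := by
  obtain ⟨f, hf⟩ := (mem_cyclicLocus_iff _).1 (p x).2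
  refine ⟨f, ?_⟩
  rw [← preimage_wordDet]
  exact hf

/-- A framed triple of global functions, one of whose word determinants is invertible near each
point, defines a point of the scheme of cyclic framed triples. -/
lemma exists_point (s : T ⟶ Spec (CommRingCat.of k)) (t : FramedTriple n Γ(T, ⊤))
    (ht : ∀ x : T, ∃ f, x ∈ T.basicOpen (t.wordDet f)) :
    ∃ p : T ⟶ cyclicTriples k n, p ≫ cyclicTriplesStr k n = s ∧ pointTriple p = t := by
  let φ : CommRingCat.of (MvPolynomial (Coord n) k) ⟶ Γ(T, ⊤) :=
    CommRingCat.ofHom (MvPolynomial.eval₂Hom (specHom s) t.coords)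
  let g : T ⟶ tripleSpace k n := T.toSpecΓ ≫ Spec.map φ
  have hg : specHom g = MvPolynomial.eval₂Hom (specHom s) t.coords := specHom_toSpecΓ φ
  have hrange : Set.range g ⊆ Set.range (cyclicLocus k n).ι := by
    rintro _ ⟨x, rfl⟩
    rw [Scheme.Opens.range_ι]
    obtain ⟨f, hf⟩ := ht x
    refine (mem_cyclicLocus_iff _).2 ⟨f, ?_⟩
    have : x ∈ g ⁻¹ᵁ PrimeSpectrum.basicOpen ((generic k n).wordDet f) := by
      rwa [preimage_basicOpen_eq, ← FramedTriple.wordDet_map, hg, generic_map_eval₂Hom]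
    exact this
  refine ⟨IsOpenImmersion.lift (cyclicLocus k n).ι g hrange, ?_, ?_⟩
  · rw [cyclicTriplesStr, IsOpenImmersion.lift_fac_assoc]
    apply specHom_ext
    rw [specHom_comp_SpecMap, hg]
    ext c
    simp
  · rw [pointTriple_def, IsOpenImmersion.lift_fac, hg, generic_map_eval₂Hom]

section ring

variable {R S : Type u} [CommRing R] [CommRing S]

lemma pointTriple_eq_ringPointTriple_map (p : Spec (CommRingCat.of R) ⟶ cyclicTriples k n) :
    pointTriple p = (ringPointTriple p).map (Scheme.ΓSpecIso (CommRingCat.of R)).inv.hom := by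
  rw [ringPointTriple, FramedTriple.map_map, ← CommRingCat.hom_comp, Iso.hom_inv_id]
  rfl

lemma ringPointTriple_SpecMap_comp (φ : R →+* S)
    (p : Spec (CommRingCat.of R) ⟶ cyclicTriples k n) :
    ringPointTriple (Spec.map (CommRingCat.ofHom φ) ≫ p) = (ringPointTriple p).map φ := by
  rw [ringPointTriple, pointTriple_comp, ringPointTriple, FramedTriple.map_map,
    FramedTriple.map_map, ← CommRingCat.hom_comp, Scheme.ΓSpecIso_naturality]
  rfl

lemma ringPointTriple_unitWordDets (p : Spec (CommRingCat.of R) ⟶ cyclicTriples k n) :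
    (ringPointTriple p).UnitWordDets := by
  by_contra hne
  obtain ⟨m, hm, hle⟩ := Ideal.exists_le_maximal _ hne
  let x : PrimeSpectrum R := ⟨m, hm.isPrime⟩
  obtain ⟨f, hf⟩ := exists_mem_basicOpen_wordDet p x
  rw [pointTriple_eq_ringPointTriple_map, FramedTriple.wordDet_map] at hf
  rw [basicOpen_eq_of_affine] at hf
  refine hf (hle (Ideal.subset_span ⟨f, rfl⟩))

lemma exists_ringPoint [Algebra k R] (t : FramedTriple n R) (ht : t.UnitWordDets) :
    ∃ p : Spec (CommRingCat.of R) ⟶ cyclicTriples k n,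
      p ≫ cyclicTriplesStr k n = Spec.map (CommRingCat.ofHom (algebraMap k R)) ∧
        ringPointTriple p = t := by
  obtain ⟨p, hp, hpt⟩ := exists_point (T := Spec (CommRingCat.of R))
    (Spec.map (CommRingCat.ofHom (algebraMap k R)))
    (t.map (Scheme.ΓSpecIso (CommRingCat.of R)).inv.hom) (fun x => by
      by_contra! hx
      have hle : Ideal.span (Set.range t.wordDet) ≤ x.asIdeal := by
        rw [Ideal.span_le]
        rintro _ ⟨f, rfl⟩
        have := hx f
        rw [FramedTriple.wordDet_map, basicOpen_eq_of_affine] at this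
        by_contra hf
        exact this hf
      rw [show Ideal.span (Set.range t.wordDet) = ⊤ from ht] at hle
      exact x.isPrime.ne_top (top_le_iff.1 hle))
  refine ⟨p, hp, ?_⟩
  rw [ringPointTriple, hpt, FramedTriple.map_map, ← CommRingCat.hom_comp, Iso.inv_hom_id]
  rfl

end ring

end HilbCrit

namespace HilbCrit

/-! ### Local structure of a quotient -/

section sections

variable {T T' : Scheme.{u}} {R : CommRingCat.{u}}

/-- The ring homomorphism `R → Γ(T, U)` of a morphism `T ⟶ Spec R`. -/
def specHomOn (f : T ⟶ Spec R) (U : T.Opens) : R →+* Γ(T, U) :=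
  ((Scheme.ΓSpecIso R).inv ≫ f.appLE ⊤ U le_top).hom

lemma specHomOn_top (f : T ⟶ Spec R) : specHomOn f ⊤ = specHom f := by
  rw [specHomOn, specHom, Scheme.Hom.appTop, Scheme.Hom.app_eq_appLE]
  rfl

lemma appLE_comp_specHomOn (h : T' ⟶ T) (f : T ⟶ Spec R) (U : T.Opens) (V : T'.Opens)
    (e : V ≤ h ⁻¹ᵁ U) : (h.appLE U V e).hom.comp (specHomOn f U) = specHomOn (h ≫ f) V := by
  rw [specHomOn, specHomOn, ← CommRingCat.hom_comp, Category.assoc]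
  congr 2
  exact Scheme.Hom.appLE_comp_appLE h f ⊤ U V le_top e

lemma specHomOn_comp_SpecMap {R' : CommRingCat.{u}} (f : T ⟶ Spec R) (φ : R' ⟶ R) (U : T.Opens) :
    specHomOn (f ≫ Spec.map φ) U = (specHomOn f U).comp φ.hom := by
  rw [← appLE_comp_specHomOn f (Spec.map φ) ⊤ U le_top, specHomOn_top, specHomOn,
    CommRingCat.hom_comp, RingHom.comp_assoc]
  congr 1
  have := specHom_comp_SpecMap (𝟙 (Spec R)) φ
  rw [Category.id_comp] at this
  rw [this]
  simp [specHom]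

lemma homOfLE_appTop_comp_topIso_hom {X : Scheme.{u}} {U V : X.Opens} (e : U ≤ V) :
    (X.homOfLE e).appTop ≫ U.topIso.hom = V.topIso.hom ≫ X.presheaf.map (homOfLE e).op := by
  rw [Scheme.homOfLE_appTop, Scheme.Opens.topIso_hom, Scheme.Opens.topIso_hom]
  refine (X.presheaf.map_comp _ _).symm.trans (Eq.trans ?_ (X.presheaf.map_comp _ _))
  exact congrArg X.presheaf.map (Subsingleton.elim _ _)

lemma ι_appTop_comp_topIso_hom {X : Scheme.{u}} (U : X.Opens) :
    U.ι.appTop ≫ U.topIso.hom = X.presheaf.map (homOfLE (le_top : U ≤ ⊤)).op := by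
  rw [Scheme.Opens.ι_appTop, Scheme.Opens.topIso_hom]
  exact (X.presheaf.map_comp _ _).symm

lemma ι_appLE_comp_topIso_hom {X : Scheme.{u}} (U : X.Opens) :
    U.ι.appLE U ⊤ U.ι_preimage_self.ge ≫ U.topIso.hom = 𝟙 _ := by
  rw [Scheme.Opens.ι_appLE, Scheme.Opens.topIso_hom]
  exact (X.presheaf.map_comp _ _).symm.trans (X.presheaf.map_id _)

/-- Functions given on an open cover and agreeing on overlaps glue uniquely. -/
lemma existsUnique_glue_function {X : Scheme.{u}} {ι : Type*} (U : ι → X.Opens)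
    (hU : ∀ x : X, ∃ i, x ∈ U i) (s : ∀ i, Γ((U i).toScheme, ⊤))
    (hs : ∀ i j, (X.homOfLE (inf_le_left : U i ⊓ U j ≤ U i)).appTop.hom (s i) =
      (X.homOfLE (inf_le_right : U i ⊓ U j ≤ U j)).appTop.hom (s j)) :
    ∃! f : Γ(X, ⊤), ∀ i, (U i).ι.appTop.hom f = s i := by
  have hres : ∀ i (f : Γ(X, ⊤)), (U i).ι.appTop.hom f = s i ↔
      X.presheaf.map (homOfLE (le_top : U i ≤ ⊤)).op f = (U i).topIso.hom (s i) := by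
    intro i f
    rw [← ι_appTop_comp_topIso_hom]
    exact (U i).topIso.commRingCatIsoToRingEquiv.injective.eq_iff.symm
  simp only [hres]
  refine X.sheaf.existsUnique_gluing' U ⊤ (fun i => homOfLE le_top) ?_ _ ?_
  · intro x _
    obtain ⟨i, hi⟩ := hU x
    exact TopologicalSpace.Opens.mem_iSup.2 ⟨i, hi⟩
  · intro i j
    have h1 := congrArg (U i ⊓ U j).topIso.hom.hom (hs i j)
    have h2 := fun a => RingHom.congr_fun (congrArg CommRingCat.Hom.hom
      (homOfLE_appTop_comp_topIso_hom (inf_le_left : U i ⊓ U j ≤ U i))) a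
    have h3 := fun a => RingHom.congr_fun (congrArg CommRingCat.Hom.hom
      (homOfLE_appTop_comp_topIso_hom (inf_le_right : U i ⊓ U j ≤ U j))) a
    exact ((h2 _).symm.trans h1).trans (h3 _)

end sections

variable {k : Type u} [Field k] {n : ℕ} {M : Scheme.{u}} {s : M ⟶ Spec (CommRingCat.of k)}
  {π : cyclicTriples k n ⟶ M}

namespace IsGLQuotient

variable (hπ : IsGLQuotient s π)
include hπ

lemma exists_smul_eq {T : Scheme.{u}} {p q : T ⟶ cyclicTriples k n} (h : p ≫ π = q ≫ π) :
    ∃ g : GL (Fin n) Γ(T, ⊤), pointTriple q = g • pointTriple p := by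
  have hs : p ≫ cyclicTriplesStr k n = q ≫ cyclicTriplesStr k n := by
    rw [← hπ.comp_str, ← Category.assoc, h, Category.assoc]
  exact (hπ.orbits T p q hs).1 h

lemma potential_eq {T : Scheme.{u}} {p q : T ⟶ cyclicTriples k n} (h : p ≫ π = q ≫ π) :
    (pointTriple p).potential = (pointTriple q).potential := by
  obtain ⟨g, hg⟩ := hπ.exists_smul_eq h
  rw [hg, FramedTriple.potential_smul]

lemma pairwiseCommute_iff {T : Scheme.{u}} {p q : T ⟶ cyclicTriples k n} (h : p ≫ π = q ≫ π) :
    (pointTriple p).PairwiseCommute ↔ (pointTriple q).PairwiseCommute := by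
  obtain ⟨g, hg⟩ := hπ.exists_smul_eq h
  rw [hg, FramedTriple.pairwiseCommute_smul_iff]

/-- Around every point there is an affine open subscheme `W` with a section `σ` over it, such that
`W` is a retract of an affine open subscheme `V` of the space of cyclic triples. -/
lemma exists_chart (x : M) : ∃ (W : M.affineOpens) (_ : x ∈ W.1)
    (σ : W.1.toScheme ⟶ cyclicTriples k n) (_ : σ ≫ π = W.1.ι)
    (V : (cyclicTriples k n).affineOpens), V.1 ≤ π ⁻¹ᵁ W.1 ∧ ⊤ ≤ σ ⁻¹ᵁ V.1 := by
  obtain ⟨W₀, hx₀, σ₀, hσ₀⟩ := hπ.locallySplit x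
  obtain ⟨W₁, hW₁, hx₁, hW₁₀⟩ := exists_isAffineOpen_mem_and_subset hx₀
  have hW₁₀' : W₁ ≤ W₀ := hW₁₀
  let σ₁ := M.homOfLE hW₁₀' ≫ σ₀
  have hσ₁ : σ₁ ≫ π = W₁.ι := by simp [σ₁, hσ₀]
  have hpre : ∀ Y : M.Opens, σ₁ ⁻¹ᵁ (π ⁻¹ᵁ Y) = W₁.ι ⁻¹ᵁ Y := by
    intro Y
    rw [← Scheme.Hom.comp_preimage, hσ₁]
  obtain ⟨V₀, hV₀, hy₀, hV₀W⟩ := exists_isAffineOpen_mem_and_subset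
    (U := π ⁻¹ᵁ W₁) (x := σ₁ ⟨x, hx₁⟩) (by
      change (⟨x, hx₁⟩ : W₁.toScheme) ∈ σ₁ ⁻¹ᵁ (π ⁻¹ᵁ W₁)
      rw [hpre]
      exact hx₁)
  obtain ⟨e, he, hxe⟩ := hW₁.exists_basicOpen_le (V := W₁.ι ''ᵁ (σ₁ ⁻¹ᵁ V₀))
    ⟨x, ⟨⟨x, hx₁⟩, hy₀, rfl⟩⟩ hx₁
  have heW : M.basicOpen e ≤ W₁ := M.basicOpen_le e
  have hV₀W' : V₀ ≤ π ⁻¹ᵁ W₁ := hV₀W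
  have hV : (cyclicTriples k n).basicOpen ((π.appLE W₁ V₀ hV₀W').hom e) =
      V₀ ⊓ π ⁻¹ᵁ M.basicOpen e := Scheme.basicOpen_appLE _ _ _ _ _
  have hVaff : IsAffineOpen (V₀ ⊓ π ⁻¹ᵁ M.basicOpen e) := hV ▸ hV₀.basicOpen _
  refine ⟨⟨M.basicOpen e, hW₁.basicOpen e⟩, hxe, M.homOfLE heW ≫ σ₁, by simp [hσ₁],
    ⟨_, hVaff⟩, inf_le_right, ?_⟩
  · rintro y -
    refine ⟨?_, ?_⟩
    · change M.homOfLE heW y ∈ σ₁ ⁻¹ᵁ V₀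
      obtain ⟨z, hz, hzy⟩ := he y.2
      have : M.homOfLE heW y = z :=
        Subtype.ext ((Scheme.homOfLE_apply heW y).trans hzy.symm)
      rw [this]
      exact hz
    · have : M.homOfLE heW y ∈ σ₁ ⁻¹ᵁ (π ⁻¹ᵁ M.basicOpen e) := by
        rw [hpre]
        exact (congrArg (· ∈ M.basicOpen e) (Scheme.homOfLE_apply heW y)).mpr y.2
      exact this

/-- Over a chart, the quotient is smooth over `k`, and the critical ideal of the descended potential
is the commutator ideal of the triple given by the section. -/
lemma chart_critical {W : M.affineOpens} {σ : W.1.toScheme ⟶ cyclicTriples k n}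
    (hσ : σ ≫ π = W.1.ι) {V : (cyclicTriples k n).affineOpens} (hVW : V.1 ≤ π ⁻¹ᵁ W.1)
    (hWV : ⊤ ≤ σ ⁻¹ᵁ V.1) :
    ((Scheme.ΓSpecIso (CommRingCat.of k)).inv ≫ s.appLE ⊤ W le_top).hom.Smooth ∧
    ∀ f : Γ(M, ⊤), π.appTop.hom f = cyclicPotential k n →
      criticalIdeal s f W = ((pointTriple σ).map W.1.topIso.hom.hom).commIdeal := by
  let i : Γ(M, W) →+* Γ(cyclicTriples k n, V) := (π.appLE W V hVW).hom
  let r : Γ(cyclicTriples k n, V) →+* Γ(M, W) := (σ.appLE V ⊤ hWV ≫ W.1.topIso.hom).hom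
  let ε : MvPolynomial (Coord n) k →+* Γ(cyclicTriples k n, V) :=
    ((Scheme.ΓSpecIso (CommRingCat.of (MvPolynomial (Coord n) k))).inv ≫
      (cyclicLocus k n).ι.appLE ⊤ V le_top).hom
  have hε : ε.Etale := by
    have h1 := (cyclicLocus k n).ι.etale_appLE (isAffineOpen_top _) V.2 le_top
    exact RingHom.Etale.stableUnderComposition _ _
      (RingHom.Etale.of_bijective
        (Scheme.ΓSpecIso
          (CommRingCat.of (MvPolynomial (Coord n) k))).symm.commRingCatIsoToRingEquiv.bijective) h1
  have hri : r.comp i = RingHom.id _ := by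
    have h1 : π.appLE W V hVW ≫ σ.appLE V ⊤ hWV = W.1.ι.appLE W ⊤ W.1.ι_preimage_self.ge := by
      rw [Scheme.Hom.appLE_comp_appLE]
      simp only [hσ]
    have h2 : (π.appLE W V hVW ≫ σ.appLE V ⊤ hWV) ≫ W.1.topIso.hom = 𝟙 _ := by
      rw [h1, ι_appLE_comp_topIso_hom]
    rw [Category.assoc] at h2
    exact congrArg CommRingCat.Hom.hom h2
  have hi : i.comp ((Scheme.ΓSpecIso (CommRingCat.of k)).inv ≫ s.appLE ⊤ W le_top).hom =
      ε.comp MvPolynomial.C := by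
    change i.comp (specHomOn s W) = (specHomOn (cyclicLocus k n).ι V).comp _
    rw [appLE_comp_specHomOn, hπ.comp_str, cyclicTriplesStr, specHomOn_comp_SpecMap]
    rfl
  obtain ⟨h1, h2⟩ := criticalIdealAlg_of_retract _ ε hε i r hri hi
  refine ⟨h1, fun f hf => ?_⟩
  rw [criticalIdeal]
  refine (h2 _ ?_).trans ?_
  · have e1 : i ((M.presheaf.map (homOfLE (le_top : W.1 ≤ ⊤)).op).hom f) =
        (((cyclicTriples k n).presheaf.map (homOfLE (le_top : V.1 ≤ ⊤)).op).hom
          (π.appTop.hom f)) := by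
      have h1 : M.presheaf.map (homOfLE (le_top : W.1 ≤ ⊤)).op ≫ π.appLE W V hVW =
          π.appTop ≫ (cyclicTriples k n).presheaf.map (homOfLE (le_top : V.1 ≤ ⊤)).op := by
        rw [Scheme.Hom.map_appLE]
        rfl
      exact RingHom.congr_fun (congrArg CommRingCat.Hom.hom h1) f
    have e2 : cyclicPotential k n = specHom (cyclicLocus k n).ι (generic k n).potential := by
      rw [cyclicPotential, pointTriple_def, Category.id_comp, FramedTriple.potential_map]
    rw [e1, hf, e2]
    rfl
  · congr 1
    rw [pointTriple_def, FramedTriple.map_map, ← specHomOn_top, ← appLE_comp_specHomOn σ _ V ⊤ hWV]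
    rfl

end IsGLQuotient

end HilbCrit

namespace HilbCrit

/-! ### Smoothness and the critical locus of a quotient -/

variable {k : Type u} [Field k] {n : ℕ} {M : Scheme.{u}} {s : M ⟶ Spec (CommRingCat.of k)}
  {π : cyclicTriples k n ⟶ M}

lemma appTop_cyclicPotential {T : Scheme.{u}} (p : T ⟶ cyclicTriples k n) :
    p.appTop.hom (cyclicPotential k n) = (pointTriple p).potential := by
  rw [cyclicPotential, ← FramedTriple.potential_map, ← pointTriple_comp, Category.comp_id]

namespace IsGLQuotient

variable (hπ : IsGLQuotient s π)
include hπ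

/-- The quotient of the space of cyclic triples is smooth, because it is locally a retract of a
smooth scheme. -/
theorem smooth : Smooth s := by
  rw [HasRingHomProperty.iff_exists_appLE (P := @Smooth)
    (RingHom.Smooth.stableUnderComposition.stableUnderCompositionWithLocalizationAway
      RingHom.Smooth.holdsForLocalizationAway).1]
  intro x
  obtain ⟨W, hx, σ, hσ, V, hVW, hWV⟩ := hπ.exists_chart x
  refine ⟨⟨⊤, isAffineOpen_top _⟩, W, hx, le_top, ?_⟩
  have h1 := (hπ.chart_critical hσ hVW hWV).1
  have h2 := RingHom.Smooth.respectsIso.2 _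
    (Scheme.ΓSpecIso (CommRingCat.of k)).commRingCatIsoToRingEquiv h1
  have h3 : (s.appLE ⊤ W le_top) = (Scheme.ΓSpecIso (CommRingCat.of k)).hom ≫
      (Scheme.ΓSpecIso (CommRingCat.of k)).inv ≫ s.appLE ⊤ W le_top := by simp
  rw [h3]
  exact h2

/-- The function `Tr([A, B] C)` descends to the quotient. -/
theorem existsUnique_potential :
    ∃! f : Γ(M, ⊤), π.appTop.hom f = cyclicPotential k n := by
  choose W hxW σ hσ using hπ.locallySplit
  have key : ∀ x (f : Γ(M, ⊤)), π.appTop.hom f = cyclicPotential k n →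
      (W x).ι.appTop.hom f = (pointTriple (σ x)).potential := by
    intro x f hf
    rw [← appTop_cyclicPotential, ← hf, ← hσ x, Scheme.Hom.comp_appTop]
    rfl
  obtain ⟨f, hf, huniq⟩ := existsUnique_glue_function W (fun x => ⟨x, hxW x⟩)
    (fun x => (pointTriple (σ x)).potential) (fun x y => by
      rw [← FramedTriple.potential_map, ← FramedTriple.potential_map, ← pointTriple_comp,
        ← pointTriple_comp]
      refine hπ.potential_eq ?_
      rw [Category.assoc, Category.assoc, hσ, hσ, Scheme.homOfLE_ι, Scheme.homOfLE_ι])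
  refine ⟨f, ?_, fun f' hf' => huniq f' fun x => key x f' hf'⟩
  obtain ⟨F, -, hF⟩ := existsUnique_glue_function (X := cyclicTriples k n) (fun x => π ⁻¹ᵁ W x)
    (fun y => ⟨π y, hxW (π y)⟩)
    (fun x => (pointTriple (π ⁻¹ᵁ W x).ι).potential) (fun x y => by
      rw [← FramedTriple.potential_map, ← FramedTriple.potential_map, ← pointTriple_comp,
        ← pointTriple_comp, Scheme.homOfLE_ι, Scheme.homOfLE_ι])
  refine (hF _ fun x => ?_).trans (hF _ fun x => ?_).symm
  · have h1 : ((π ⁻¹ᵁ W x).ι ≫ π).appTop.hom f = ((π ∣_ W x) ≫ (W x).ι).appTop.hom f := by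
      rw [morphismRestrict_ι]
    rw [Scheme.Hom.comp_appTop, Scheme.Hom.comp_appTop] at h1
    have h2 : (π ∣_ W x).appTop.hom ((W x).ι.appTop.hom f) =
        (pointTriple ((π ∣_ W x) ≫ σ x)).potential := by
      rw [hf, pointTriple_comp, FramedTriple.potential_map]
    refine h1.trans (h2.trans (hπ.potential_eq ?_))
    rw [Category.assoc, hσ, morphismRestrict_ι]
  · exact appTop_cyclicPotential _

/-- The critical ideals form a quasi-coherent sheaf of ideals. -/
theorem exists_criticalIdealSheaf (f : Γ(M, ⊤)) :
    ∃ I : M.IdealSheafData, IsCriticalIdealSheaf s f I := by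
  have hs := hπ.smooth
  have hsm : ∀ W : M.affineOpens, (specHomOn s W).Smooth := by
    intro W
    exact RingHom.Smooth.comp (RingHom.Smooth.of_bijective
      (Scheme.ΓSpecIso (CommRingCat.of k)).symm.commRingCatIsoToRingEquiv.bijective)
      (s.smooth_appLE (isAffineOpen_top _) W.2 le_top)
  refine ⟨⟨fun W => criticalIdeal s f W, ?_, _, rfl⟩, fun W => rfl⟩
  intro W e
  have he : ((M.presheaf.map (homOfLE (M.basicOpen_le e)).op).hom).Etale := by
    have h1 := (𝟙 M : M ⟶ M).etale_appLE W.2 (W.2.basicOpen e) (M.basicOpen_le e)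
    have h2 : (𝟙 M : M ⟶ M).appLE W (M.basicOpen e) (M.basicOpen_le e) =
        M.presheaf.map (homOfLE (M.basicOpen_le e)).op := by
      change (𝟙 M : M ⟶ M).app W ≫ M.presheaf.map _ = _
      rw [Scheme.Hom.id_app]
      exact Category.id_comp _
    rwa [h2] at h1
  have h := criticalIdealAlg_map_of_etale (specHomOn s W) (hsm W) _ he
    (specHomOn s (M.basicOpen e)) (by
      rw [specHomOn, specHomOn, ← CommRingCat.hom_comp, Category.assoc]
      congr 2
      exact Scheme.Hom.appLE_map _ _ _)
    ((M.presheaf.map (homOfLE (le_top : W.1 ≤ ⊤)).op).hom f)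
  refine h.trans ?_
  rw [← RingHom.comp_apply, ← CommRingCat.hom_comp, ← M.presheaf.map_comp]
  rfl

/-- Over a chart, a morphism to the quotient kills the critical ideal exactly when the triples that
it comes from commute. -/
lemma criticalIdeal_le_ker_iff {f : Γ(M, ⊤)} (hf : π.appTop.hom f = cyclicPotential k n)
    {W : M.affineOpens} {σ : W.1.toScheme ⟶ cyclicTriples k n}
    (hσ : σ ≫ π = W.1.ι) {V : (cyclicTriples k n).affineOpens} (hVW : V.1 ≤ π ⁻¹ᵁ W.1)
    (hWV : ⊤ ≤ σ ⁻¹ᵁ V.1) {T : Scheme.{u}} (p : T ⟶ cyclicTriples k n) :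
    criticalIdeal s f W ≤ RingHom.ker ((p ≫ π).app W).hom ↔
      (pointTriple (((p ≫ π) ⁻¹ᵁ W.1).ι ≫ p)).PairwiseCommute := by
  have h1 : (((p ≫ π) ⁻¹ᵁ W.1).ι ≫ p) ≫ π = ((p ≫ π) ∣_ W.1 ≫ σ) ≫ π := by
    rw [Category.assoc, Category.assoc, hσ, morphismRestrict_ι]
  rw [hπ.pairwiseCommute_iff h1, (hπ.chart_critical hσ hVW hWV).2 f hf,
    FramedTriple.commIdeal_le_ker_iff, pointTriple_comp, FramedTriple.map_map]
  have h2 : W.1.topIso.hom ≫ (p ≫ π).app W = ((p ≫ π) ∣_ W.1).appTop ≫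
      ((p ≫ π) ⁻¹ᵁ W.1).topIso.hom := by
    rw [← Scheme.Hom.resLE_eq_morphismRestrict, Scheme.Hom.appTop, Scheme.Hom.resLE_app_top,
      Category.assoc, Category.assoc, Iso.inv_hom_id, Category.comp_id, Scheme.Hom.app_eq_appLE]
  rw [← CommRingCat.hom_comp, h2, CommRingCat.hom_comp, ← FramedTriple.map_map]
  constructor
  · intro h
    have := h.map ((p ≫ π) ⁻¹ᵁ W.1).topIso.inv.hom
    rw [FramedTriple.map_map, ← CommRingCat.hom_comp, Iso.hom_inv_id] at this
    exact this
  · intro h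
    exact h.map _

end IsGLQuotient

lemma exists_comp_subschemeι_iff (I : M.IdealSheafData) {T : Scheme.{u}} (g : T ⟶ M) :
    (∃ q : T ⟶ I.subscheme, q ≫ I.subschemeι = g) ↔
      ∀ W : M.affineOpens, I.ideal W ≤ RingHom.ker (g.app W).hom := by
  have : (∀ W : M.affineOpens, I.ideal W ≤ RingHom.ker (g.app W).hom) ↔ I ≤ g.ker :=
    Scheme.IdealSheafData.le_ofIdeals_iff.symm
  rw [this]
  constructor
  · rintro ⟨q, rfl⟩
    conv_lhs => rw [← I.ker_subschemeι]
    exact Scheme.Hom.le_ker_comp q I.subschemeι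
  · intro h
    exact ⟨g.toImage ≫ Scheme.IdealSheafData.inclusion h, by simp⟩

lemma pairwiseCommute_of_cover {T : Scheme.{u}} (p : T ⟶ cyclicTriples k n)
    (h : ∀ x : T, ∃ (W : T.Opens) (_ : x ∈ W), (pointTriple (W.ι ≫ p)).PairwiseCommute) :
    (pointTriple p).PairwiseCommute := by
  choose W hxW hW using h
  rw [FramedTriple.pairwiseCommute_iff_comm]
  intro i j
  ext a b
  obtain ⟨F, -, hF⟩ := existsUnique_glue_function W (fun y => ⟨y, hxW y⟩) (fun x => 0) (by simp)
  refine (hF _ fun x => ?_).trans (hF _ fun x => ?_).symm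
  · have := (FramedTriple.pairwiseCommute_iff_comm _).1 (hW x) i j
    rw [pointTriple_comp, FramedTriple.comm_map] at this
    exact congrFun (congrFun this a) b
  · exact map_zero _

namespace IsGLQuotient

/-- A point of the quotient that comes from a triple lies on the critical locus if and only if the
three matrices commute. -/
theorem exists_comp_subschemeι_iff_pairwiseCommute (hπ : IsGLQuotient s π) {f : Γ(M, ⊤)}
    (hf : π.appTop.hom f = cyclicPotential k n)
    {I : M.IdealSheafData} (hI : IsCriticalIdealSheaf s f I) {T : Scheme.{u}}
    (p : T ⟶ cyclicTriples k n) :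
    (∃ q : T ⟶ I.subscheme, q ≫ I.subschemeι = p ≫ π) ↔ (pointTriple p).PairwiseCommute := by
  rw [exists_comp_subschemeι_iff]
  constructor
  · intro h
    refine pairwiseCommute_of_cover p fun x => ?_
    obtain ⟨W, hx, σ, hσ, V, hVW, hWV⟩ := hπ.exists_chart ((p ≫ π) x)
    refine ⟨(p ≫ π) ⁻¹ᵁ W.1, hx, ?_⟩
    rw [← hπ.criticalIdeal_le_ker_iff hf hσ hVW hWV p, ← hI W]
    exact h W
  · intro h W a ha
    rw [RingHom.mem_ker]
    -- The vanishing of the pullback of `a` is local on `T`, so `W` may be shrunk to lie in a chart.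
    apply T.IsSheaf.section_ext
    intro x hx
    obtain ⟨W', hx', σ, hσ, V, hVW, hWV⟩ := hπ.exists_chart ((p ≫ π) x)
    have hW' : I.ideal W' ≤ RingHom.ker ((p ≫ π).app W').hom := by
      rw [hI W', hπ.criticalIdeal_le_ker_iff hf hσ hVW hWV p, pointTriple_comp]
      exact h.map _
    obtain ⟨W₂, hW₂, hx₂, hle⟩ := exists_isAffineOpen_mem_and_subset
      (U := W.1 ⊓ W'.1) (x := (p ≫ π) x) ⟨hx, hx'⟩
    have hle1 : W₂ ≤ W.1 := le_trans hle inf_le_left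
    have hle2 : W₂ ≤ W'.1 := le_trans hle inf_le_right
    have h1 : (M.presheaf.map (homOfLE hle1).op).hom a ∈ I.ideal ⟨W₂, hW₂⟩ :=
      I.ideal_le_comap_ideal (U := ⟨W₂, hW₂⟩) (V := W) hle1 ha
    have h2 : I.ideal ⟨W₂, hW₂⟩ ≤ RingHom.ker ((p ≫ π).app W₂).hom := by
      rw [← I.map_ideal (U := ⟨W₂, hW₂⟩) (V := W') hle2, Ideal.map_le_iff_le_comap,
        RingHom.comap_ker, ← CommRingCat.hom_comp, Scheme.Hom.naturality, CommRingCat.hom_comp,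
        ← RingHom.comap_ker]
      exact hW'.trans (Ideal.ker_le_comap _)
    refine ⟨(p ≫ π) ⁻¹ᵁ W₂, (p ≫ π).preimage_mono hle1, hx₂, ?_⟩
    have h3 := h2 h1
    rw [RingHom.mem_ker, ← RingHom.comp_apply, ← CommRingCat.hom_comp,
      Scheme.Hom.naturality] at h3
    rw [map_zero]
    exact h3

end IsGLQuotient

end HilbCrit

namespace HilbCrit

/-! ### Commuting cyclic triples and ideals of finite length -/

section describes

variable {n : ℕ} {R R' : Type*} [CommRing R] [CommRing R']

/-- The linear map `f ↦ f(A, B, C) v` of a framed triple, characterized by its value at `1` and its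
compatibility with multiplication by the variables. -/
structure IsEval (t : FramedTriple n R) (e : MvPolynomial (Fin 3) R →ₗ[R] Fin n → R) : Prop where
  one : e 1 = t.v
  X_mul : ∀ i f, e (MvPolynomial.X i * f) = t.A i *ᵥ e f

/-- Evaluation maps are compatible with base change. -/
lemma IsEval.map_apply {t : FramedTriple n R} {e : MvPolynomial (Fin 3) R →ₗ[R] Fin n → R}
    (he : IsEval t e) (φ : R →+* R') {e' : MvPolynomial (Fin 3) R' →ₗ[R'] Fin n → R'}
    (he' : IsEval (t.map φ) e') (f : MvPolynomial (Fin 3) R) :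
    e' (MvPolynomial.map φ f) = fun j => φ (e f j) := by
  induction f using MvPolynomial.induction_on with
  | C a =>
    have h1 : e (MvPolynomial.C a) = a • t.v := by
      rw [← he.one, ← map_smul, MvPolynomial.smul_eq_C_mul, mul_one]
    have h2 : e' (MvPolynomial.C (φ a)) = φ a • (t.map φ).v := by
      rw [← he'.one, ← map_smul, MvPolynomial.smul_eq_C_mul, mul_one]
    rw [MvPolynomial.map_C, h1, h2]
    ext j
    simp
  | add f g hf hg =>
    ext j
    simp [hf, hg]
  | mul_X f i hf =>
    rw [mul_comm, map_mul, MvPolynomial.map_X, he'.X_mul, he.X_mul, hf]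
    ext j
    rw [RingHom.map_mulVec]
    rfl

lemma IsEval.unique {t : FramedTriple n R} {e e' : MvPolynomial (Fin 3) R →ₗ[R] Fin n → R}
    (he : IsEval t e) (he' : IsEval t e') : e = e' := by
  refine LinearMap.ext fun f => ?_
  have := he.map_apply (RingHom.id R) (e' := e') he' f
  rw [MvPolynomial.map_id] at this
  exact this.symm

lemma exists_isEval {t : FramedTriple n R} (h : t.PairwiseCommute) : ∃ e, IsEval t e := by
  let S := Algebra.adjoin R (Set.range t.A)
  have : IsMulCommutative S := Algebra.isMulCommutative_adjoin R (by
    rintro _ ⟨i, rfl⟩ _ ⟨j, rfl⟩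
    exact h i j)
  let _ : CommRing S := { S.toRing with mul_comm := mul_comm' }
  let φ : MvPolynomial (Fin 3) R →ₐ[R] S :=
    MvPolynomial.aeval fun i => (⟨t.A i, Algebra.subset_adjoin ⟨i, rfl⟩⟩ : S)
  let ψ : MvPolynomial (Fin 3) R →ₗ[R] Matrix (Fin n) (Fin n) R :=
    S.val.toLinearMap ∘ₗ φ.toLinearMap
  have h1 : ψ 1 = 1 := by simp [ψ]
  have h2 : ∀ i f, ψ (MvPolynomial.X i * f) = t.A i * ψ f := by
    intro i f
    have : φ (MvPolynomial.X i * f) = ⟨t.A i, Algebra.subset_adjoin ⟨i, rfl⟩⟩ * φ f := by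
      rw [map_mul, MvPolynomial.aeval_X]
    exact congrArg Subtype.val this
  refine ⟨((Matrix.mulVecBilin R R).flip t.v) ∘ₗ ψ, ?_, ?_⟩
  · simp [h1]
  · intro i f
    simp [h2]

lemma describes_iff {t : FramedTriple n R} {J : Ideal (MvPolynomial (Fin 3) R)} :
    Describes t J ↔ ∃ e, IsEval t e ∧ Function.Surjective e ∧ ∀ f, e f = 0 ↔ f ∈ J := by
  constructor
  · rintro ⟨φ, h1, h2⟩
    refine ⟨φ.toLinearMap ∘ₗ (Ideal.Quotient.mkₐ R J).toLinearMap, ⟨?_, ?_⟩, ?_, ?_⟩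
    · simpa using h1
    · intro i f
      simpa using h2 i (Ideal.Quotient.mk J f)
    · exact φ.surjective.comp Ideal.Quotient.mk_surjective
    · intro f
      simp [Ideal.Quotient.eq_zero_iff_mem]
  · rintro ⟨e, he, hsurj, hker⟩
    have hk : J.restrictScalars R = LinearMap.ker e := by
      ext f
      exact (hker f).symm
    let φ : (MvPolynomial (Fin 3) R ⧸ J) ≃ₗ[R] (Fin n → R) :=
      (Submodule.Quotient.restrictScalarsEquiv R J).symm ≪≫ₗ
        (Submodule.quotEquivOfEq _ _ hk) ≪≫ₗ e.quotKerEquivOfSurjective hsurj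
    have hφ : ∀ f, φ (Ideal.Quotient.mk J f) = e f := fun f => rfl
    refine ⟨φ, ?_, ?_⟩
    · rw [← he.one, ← hφ]
      rfl
    · intro i m
      obtain ⟨f, rfl⟩ := Ideal.Quotient.mk_surjective m
      rw [← map_mul, hφ, hφ, he.X_mul]

/-- A triple describes at most one ideal. -/
lemma Describes.unique {t : FramedTriple n R} {J J' : Ideal (MvPolynomial (Fin 3) R)}
    (h : Describes t J) (h' : Describes t J') : J = J' := by
  obtain ⟨e, he, -, hk⟩ := describes_iff.1 h
  obtain ⟨e', he', -, hk'⟩ := describes_iff.1 h'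
  obtain rfl := he.unique he'
  ext f
  rw [← hk, ← hk']

lemma Describes.pairwiseCommute {t : FramedTriple n R} {J : Ideal (MvPolynomial (Fin 3) R)}
    (h : Describes t J) : t.PairwiseCommute := by
  obtain ⟨φ, -, h2⟩ := h
  intro i j
  apply Matrix.toLin'.injective
  refine LinearMap.ext fun x => ?_
  obtain ⟨m, rfl⟩ := φ.surjective x
  simp only [Matrix.toLin'_apply, ← Matrix.mulVec_mulVec, ← h2]
  congr 1
  ring

lemma Describes.smul {t : FramedTriple n R} {J : Ideal (MvPolynomial (Fin 3) R)}
    (h : Describes t J) (g : GL (Fin n) R) : Describes (g • t) J := by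
  obtain ⟨φ, h1, h2⟩ := h
  let γ : (Fin n → R) ≃ₗ[R] (Fin n → R) := LinearEquiv.ofLinearMap
    (Matrix.mulVecLin (g : Matrix (Fin n) (Fin n) R))
    (Matrix.mulVecLin (↑g⁻¹ : Matrix (Fin n) (Fin n) R))
    (by rw [← Matrix.mulVecLin_mul, ← Units.val_mul, mul_inv_cancel, Units.val_one,
      Matrix.mulVecLin_one])
    (by rw [← Matrix.mulVecLin_mul, ← Units.val_mul, inv_mul_cancel, Units.val_one,
      Matrix.mulVecLin_one])
  have hγ : ∀ x, γ x = (g : Matrix (Fin n) (Fin n) R) *ᵥ x := fun x => rfl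
  refine ⟨φ ≪≫ₗ γ, ?_, ?_⟩
  · rw [LinearEquiv.trans_apply, h1, hγ, FramedTriple.smul_v]
  · intro i m
    rw [LinearEquiv.trans_apply, LinearEquiv.trans_apply, h2, hγ, hγ, Matrix.mulVec_mulVec,
      Matrix.mulVec_mulVec, FramedTriple.smul_A_mul]

/-- Two triples that describe the same ideal are conjugate. -/
lemma Describes.exists_smul_eq {t t' : FramedTriple n R} {J : Ideal (MvPolynomial (Fin 3) R)}
    (h : Describes t J) (h' : Describes t' J) : ∃ g : GL (Fin n) R, t' = g • t := by
  obtain ⟨φ, h1, h2⟩ := h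
  obtain ⟨φ', h1', h2'⟩ := h'
  let ψ := φ.symm ≪≫ₗ φ'
  let g : GL (Fin n) R :=
    ⟨LinearMap.toMatrix' ψ.toLinearMap, LinearMap.toMatrix' ψ.symm.toLinearMap,
    by rw [← LinearMap.toMatrix'_comp]; simp, by rw [← LinearMap.toMatrix'_comp]; simp⟩
  have hg : ∀ m, (g : Matrix (Fin n) (Fin n) R) *ᵥ φ m = φ' m := by
    intro m
    simp [g, ψ, ← Matrix.toLin'_apply]
  refine ⟨g, ?_⟩
  have hA : ∀ i, t'.A i = (g • t).A i := by
    intro i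
    have h3 : t'.A i * (g : Matrix (Fin n) (Fin n) R) = (g : Matrix (Fin n) (Fin n) R) * t.A i := by
      apply Matrix.toLin'.injective
      refine LinearMap.ext fun x => ?_
      obtain ⟨m, rfl⟩ := φ.surjective x
      simp only [Matrix.toLin'_apply, ← Matrix.mulVec_mulVec, hg, ← h2, ← h2']
    rw [FramedTriple.smul_A, ← h3, Matrix.mul_assoc, ← Units.val_mul, mul_inv_cancel,
      Units.val_one, Matrix.mul_one]
  have hv : t'.v = (g • t).v := by
    rw [FramedTriple.smul_v, ← h1, ← h1', hg]
  ext i a b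
  · rw [hA]
  · rw [hv]

/-- A submodule containing all the vectors `w(A, B, C) v` is everything, if the word determinants
generate the unit ideal. -/
lemma FramedTriple.UnitWordDets.eq_top {t : FramedTriple n R} (h : t.UnitWordDets)
    {N : Submodule R (Fin n → R)} (hN : ∀ w, t.word w ∈ N) : N = ⊤ := by
  have key : (⊤ : Ideal R) ≤ N.colon ⊤ := by
    rw [← show Ideal.span (Set.range t.wordDet) = ⊤ from h, Ideal.span_le]
    rintro _ ⟨f, rfl⟩
    rw [SetLike.mem_coe, Submodule.mem_colon]
    intro x _
    have : t.wordDet f • x = ∑ j, ((t.wordMatrix f).adjugate *ᵥ x) j • t.word (f j) := by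
      have h1 : t.wordMatrix f *ᵥ ((t.wordMatrix f).adjugate *ᵥ x) = t.wordDet f • x := by
        rw [Matrix.mulVec_mulVec, Matrix.mul_adjugate, Matrix.smul_mulVec, Matrix.one_mulVec]
        rfl
      rw [← h1]
      funext i
      simp [Matrix.mulVec, dotProduct, wordMatrix, mul_comm]
    rw [this]
    exact Submodule.sum_mem _ fun j _ => Submodule.smul_mem _ _ (hN _)
  rw [eq_top_iff]
  intro x _
  have := Submodule.mem_colon.1 (key (Submodule.mem_top (x := (1 : R)))) x trivial
  rwa [one_smul] at this

lemma IsEval.word_mem_range {t : FramedTriple n R} {e : MvPolynomial (Fin 3) R →ₗ[R] Fin n → R}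
    (he : IsEval t e) (w : List (Fin 3)) : t.word w ∈ LinearMap.range e := by
  induction w with
  | nil => exact ⟨1, he.one⟩
  | cons i w ih =>
    obtain ⟨f, hf⟩ := ih
    exact ⟨MvPolynomial.X i * f, by rw [he.X_mul, hf]; rfl⟩

lemma IsEval.surjective {t : FramedTriple n R} {e : MvPolynomial (Fin 3) R →ₗ[R] Fin n → R}
    (he : IsEval t e) (h : t.UnitWordDets) : Function.Surjective e :=
  LinearMap.range_eq_top.1 (h.eq_top he.word_mem_range)

lemma IsEval.mem_span_word {t : FramedTriple n R} {e : MvPolynomial (Fin 3) R →ₗ[R] Fin n → R}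
    (he : IsEval t e) (f : MvPolynomial (Fin 3) R) :
    e f ∈ Submodule.span R (Set.range t.word) := by
  induction f using MvPolynomial.induction_on with
  | C a =>
    have h1 : e (MvPolynomial.C a) = a • t.v := by
      rw [← he.one, ← map_smul, MvPolynomial.smul_eq_C_mul, mul_one]
    rw [h1]
    exact Submodule.smul_mem _ _ (Submodule.subset_span ⟨[], rfl⟩)
  | add f g hf hg => rw [map_add]; exact add_mem hf hg
  | mul_X f i hf =>
    rw [mul_comm, he.X_mul]
    generalize e f = y at hf
    induction hf using Submodule.span_induction with
    | mem x hx =>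
      obtain ⟨w, rfl⟩ := hx
      exact Submodule.subset_span ⟨i :: w, rfl⟩
    | zero => simp
    | add x y _ _ hx hy => rw [Matrix.mulVec_add]; exact add_mem hx hy
    | smul a x _ hx => rw [Matrix.mulVec_smul]; exact Submodule.smul_mem _ a hx

/-- If the vectors `w(A, B, C) v` span, then the word determinants generate the unit ideal. -/
lemma FramedTriple.unitWordDets_of_span {t : FramedTriple n R}
    (h : Submodule.span R (Set.range t.word) = ⊤) : t.UnitWordDets := by
  by_contra hne
  obtain ⟨m, hm, hle⟩ := Ideal.exists_le_maximal _ hne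
  let _ := Ideal.Quotient.field m
  have hc : (t.map (Ideal.Quotient.mk m)).IsCyclic := by
    intro N hv hN
    have hw : ∀ w, (t.map (Ideal.Quotient.mk m)).word w ∈ N := by
      intro w
      induction w with
      | nil => exact hv
      | cons i w ih => exact hN i _ ih
    have hx : ∀ x : Fin n → R, (fun j => Ideal.Quotient.mk m (x j)) ∈ N := by
      intro x
      have hx : x ∈ Submodule.span R (Set.range t.word) := h ▸ Submodule.mem_top
      induction hx using Submodule.span_induction with
      | mem x hx =>
        obtain ⟨w, rfl⟩ := hx
        rw [← word_map]
        exact hw w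
      | zero =>
        convert N.zero_mem using 1
        ext j
        simp
      | add x y _ _ hx hy =>
        convert N.add_mem hx hy using 1
        ext j
        simp
      | smul a x _ hx =>
        convert N.smul_mem (Ideal.Quotient.mk m a) hx using 1
        ext j
        simp
    rw [eq_top_iff]
    intro y _
    choose x hxy using fun j => Ideal.Quotient.mk_surjective (y j)
    rw [← funext hxy]
    exact hx x
  obtain ⟨f, hf⟩ := (isCyclic_iff _).1 hc
  rw [wordDet_map] at hf
  exact hf (Ideal.Quotient.eq_zero_iff_mem.2 (hle (Ideal.subset_span ⟨f, rfl⟩)))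

lemma Describes.unitWordDets {t : FramedTriple n R} {J : Ideal (MvPolynomial (Fin 3) R)}
    (h : Describes t J) : t.UnitWordDets := by
  obtain ⟨e, he, hsurj, -⟩ := describes_iff.1 h
  apply FramedTriple.unitWordDets_of_span
  rw [eq_top_iff]
  intro x _
  obtain ⟨f, rfl⟩ := hsurj x
  exact he.mem_span_word f

/-- The kernel of an evaluation map is an ideal. -/
lemma IsEval.exists_ideal {t : FramedTriple n R} {e : MvPolynomial (Fin 3) R →ₗ[R] Fin n → R}
    (he : IsEval t e) : ∃ J : Ideal (MvPolynomial (Fin 3) R), ∀ f, e f = 0 ↔ f ∈ J := by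
  have hmul : ∀ c f, e f = 0 → e (c * f) = 0 := by
    intro c f hf
    induction c using MvPolynomial.induction_on with
    | C a => rw [← MvPolynomial.smul_eq_C_mul, map_smul, hf, smul_zero]
    | add p q hp hq => rw [add_mul, map_add, hp, hq, add_zero]
    | mul_X p i hp => rw [mul_comm p, mul_assoc, he.X_mul, hp, Matrix.mulVec_zero]
  exact ⟨{ LinearMap.ker e with smul_mem' := fun c f hf => hmul c f hf }, fun f => Iff.rfl⟩

/-- A commuting cyclic triple describes an ideal. -/
lemma exists_describes {t : FramedTriple n R} (hc : t.PairwiseCommute) (hu : t.UnitWordDets) :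
    ∃ J, Describes t J := by
  obtain ⟨e, he⟩ := exists_isEval hc
  obtain ⟨J, hJ⟩ := he.exists_ideal
  exact ⟨J, describes_iff.2 ⟨e, he, he.surjective hu, hJ⟩⟩

/-- The description of an ideal by a triple is compatible with base change. -/
lemma Describes.map {t : FramedTriple n R} {J : Ideal (MvPolynomial (Fin 3) R)}
    (h : Describes t J) (φ : R →+* R') : Describes (t.map φ) (J.map (MvPolynomial.map φ)) := by
  obtain ⟨e, he, hsurj, hk⟩ := describes_iff.1 h
  obtain ⟨e', he'⟩ := exists_isEval (h.pairwiseCommute.map φ)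
  refine describes_iff.2 ⟨e', he', he'.surjective (h.unitWordDets.map φ), fun f => ⟨?_, ?_⟩⟩
  · -- a linear section of `e` gives a section of `e'`, and subtracting the image of the section
    -- moves every polynomial into the extended ideal
    choose σ hσ using fun j : Fin n => hsurj (Pi.single j 1)
    have key : ∀ f, f - ∑ j, MvPolynomial.C (e' f j) * MvPolynomial.map φ (σ j) ∈
        J.map (MvPolynomial.map φ) := by
      intro f
      induction f using MvPolynomial.induction_on' with
      | monomial m a =>
        have h1 : MvPolynomial.monomial m a =
            a • MvPolynomial.map φ (MvPolynomial.monomial m (1 : R)) := by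
          rw [MvPolynomial.map_monomial, map_one, MvPolynomial.smul_monomial, smul_eq_mul, mul_one]
        have h2 : MvPolynomial.monomial m (1 : R) -
            ∑ j, MvPolynomial.C (e (MvPolynomial.monomial m 1) j) * σ j ∈ J := by
          rw [← hk, map_sub, map_sum, sub_eq_zero]
          simp only [← MvPolynomial.smul_eq_C_mul, map_smul, hσ]
          ext i
          simp [Pi.single_apply]
        have h3 := Ideal.mul_mem_left _ (MvPolynomial.C a)
          (Ideal.mem_map_of_mem (MvPolynomial.map φ) h2)
        rw [h1, map_smul, he.map_apply φ he']
        convert h3 using 1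
        simp only [map_sub, map_sum, map_mul, MvPolynomial.map_C, mul_sub, Finset.mul_sum,
          Pi.smul_apply, smul_eq_mul, MvPolynomial.smul_eq_C_mul, mul_assoc]
      | add p q hp hq =>
        convert add_mem hp hq using 1
        simp only [map_add, Pi.add_apply, add_mul, Finset.sum_add_distrib]
        ring
    intro hf
    have := key f
    simpa [hf] using this
  · obtain ⟨J', hJ'⟩ := he'.exists_ideal
    have : J.map (MvPolynomial.map φ) ≤ J' := by
      refine Ideal.map_le_iff_le_comap.2 fun g hg => ?_
      rw [Ideal.mem_comap, ← hJ', he.map_apply φ he', (hk g).2 hg]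
      ext j
      simp
    exact fun hf => (hJ' f).2 (this hf)

end describes

end HilbCrit

namespace HilbCrit

/-! ### Localization of ideals and of their quotients -/

section localization

variable {n : ℕ} {R : Type*} [CommRing R]

/-- The ideal that `J` generates in the polynomial ring over an `R`-algebra `S`. -/
abbrev extIdeal (S : Type*) [CommRing S] [Algebra R S] (J : Ideal (MvPolynomial (Fin 3) R)) :
    Ideal (MvPolynomial (Fin 3) S) :=
  J.map (MvPolynomial.map (algebraMap R S))

/-- The map on quotients by an ideal and by its extension. -/
def quotExt (S : Type*) [CommRing S] [Algebra R S] (J : Ideal (MvPolynomial (Fin 3) R)) :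
    (MvPolynomial (Fin 3) R ⧸ J) →ₗ[R] MvPolynomial (Fin 3) S ⧸ extIdeal S J :=
  (Ideal.quotientMapₐ (extIdeal S J)
    (MvPolynomial.mapAlgHom (Algebra.ofId R S) : MvPolynomial (Fin 3) R →ₐ[R] _)
    Ideal.le_comap_map).toLinearMap

section

attribute [local instance] MvPolynomial.algebraMvPolynomial

/-- Forming the quotient of the polynomial ring by `J` commutes with localization of the base. -/
lemma isLocalizedModule_quotExt (M : Submonoid R) (S : Type*) [CommRing S] [Algebra R S]
    [IsLocalization M S] (J : Ideal (MvPolynomial (Fin 3) R)) :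
    IsLocalizedModule M (quotExt S J) := by
  let _ : Algebra (MvPolynomial (Fin 3) R ⧸ J) (MvPolynomial (Fin 3) S ⧸ extIdeal S J) :=
    (Ideal.quotientMap (extIdeal S J) (MvPolynomial.map (algebraMap R S))
      Ideal.le_comap_map).toAlgebra
  have h1 : IsLocalization ((M.map (MvPolynomial.C (σ := Fin 3))).map (Ideal.Quotient.mk J))
      (MvPolynomial (Fin 3) S ⧸ extIdeal S J) :=
    IsLocalization.of_surjective _ (MvPolynomial (Fin 3) S) (Ideal.Quotient.mk J)
      Ideal.Quotient.mk_surjective (Ideal.Quotient.mk (extIdeal S J))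
      Ideal.Quotient.mk_surjective rfl (by rw [Ideal.mk_ker, Ideal.mk_ker]; exact le_rfl)
  have h2 : ((M.map (MvPolynomial.C (σ := Fin 3))).map (Ideal.Quotient.mk J)) =
      Algebra.algebraMapSubmonoid (MvPolynomial (Fin 3) R ⧸ J) M := Submonoid.map_map _ _ _
  rw [h2] at h1
  have : IsScalarTower R (MvPolynomial (Fin 3) R ⧸ J) (MvPolynomial (Fin 3) S ⧸ extIdeal S J) := by
    refine IsScalarTower.of_algebraMap_eq (R := R) (S := MvPolynomial (Fin 3) R ⧸ J)
      (A := MvPolynomial (Fin 3) S ⧸ extIdeal S J) fun r => ?_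
    refine Eq.trans ?_ (congrArg (Ideal.Quotient.mk (extIdeal S J))
      (MvPolynomial.map_C (algebraMap R S) r).symm)
    rfl
  exact isLocalizedModule_iff_isLocalization.2 h1

/-- A polynomial over a localization lies in an extended ideal if and only if it does so after
multiplication by a denominator. -/
lemma map_mem_extIdeal_iff (M : Submonoid R) (S : Type*) [CommRing S] [Algebra R S]
    [IsLocalization M S] {J : Ideal (MvPolynomial (Fin 3) R)} {f : MvPolynomial (Fin 3) R} :
    MvPolynomial.map (algebraMap R S) f ∈ extIdeal S J ↔
      ∃ m ∈ M, MvPolynomial.C m * f ∈ J := by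
  have := IsLocalization.algebraMap_mem_map_algebraMap_iff (M.map (MvPolynomial.C (σ := Fin 3)))
    (MvPolynomial (Fin 3) S) J f
  simpa [extIdeal] using this

lemma exists_map_eq (M : Submonoid R) (S : Type*) [CommRing S] [Algebra R S]
    [IsLocalization M S] (f : MvPolynomial (Fin 3) S) :
    ∃ m ∈ M, ∃ g : MvPolynomial (Fin 3) R,
      MvPolynomial.map (algebraMap R S) g = MvPolynomial.C (algebraMap R S m) * f := by
  obtain ⟨⟨g, m⟩, h⟩ := IsLocalization.surj (M.map (MvPolynomial.C (σ := Fin 3))) f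
  obtain ⟨_, m, hm, rfl⟩ := m
  refine ⟨m, hm, g, ?_⟩
  simp at h
  rw [mul_comm, h]

end

/-- An ideal is contained in another one if this holds after localization on a cover. -/
lemma le_of_extIdeal_le {ι : Type*} {h : ι → R} (hh : Ideal.span (Set.range h) = ⊤)
    (S : ι → Type*) [∀ i, CommRing (S i)] [∀ i, Algebra R (S i)]
    [∀ i, IsLocalization.Away (h i) (S i)] {J J' : Ideal (MvPolynomial (Fin 3) R)}
    (H : ∀ i, extIdeal (S i) J ≤ extIdeal (S i) J') : J ≤ J' := by
  intro f hf
  let 𝔞 : Ideal R := (J'.colon {f}).comap MvPolynomial.C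
  have h𝔞 : ∀ r, r ∈ 𝔞 ↔ MvPolynomial.C r * f ∈ J' := by
    intro r
    simp [𝔞, Ideal.mem_comap, Submodule.mem_colon_singleton]
  have hrad : 𝔞.radical = ⊤ := by
    rw [eq_top_iff, ← hh, Ideal.span_le]
    rintro _ ⟨i, rfl⟩
    obtain ⟨_, ⟨m, rfl⟩, hm⟩ := (map_mem_extIdeal_iff (Submonoid.powers (h i)) (S i)).1
      (H i (Ideal.mem_map_of_mem _ hf))
    exact ⟨m, (h𝔞 _).2 hm⟩
  rw [Ideal.radical_eq_top] at hrad
  have := (h𝔞 1).1 (hrad ▸ Submodule.mem_top)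
  simpa using this

/-- Ideals over the members of a finite cover by localizations, compatible on overlaps, come from
an ideal over the base. -/
lemma exists_extIdeal_eq {ι : Type*} [Finite ι] {h : ι → R}
    (S : ι → Type*) [∀ i, CommRing (S i)] [∀ i, Algebra R (S i)]
    [∀ i, IsLocalization.Away (h i) (S i)] (K : ∀ i, Ideal (MvPolynomial (Fin 3) (S i)))
    (H : ∀ i j f, MvPolynomial.map (algebraMap R (S i)) f ∈ K i →
      ∃ m, MvPolynomial.map (algebraMap R (S j)) (MvPolynomial.C (h i ^ m) * f) ∈ K j) :
    ∃ J : Ideal (MvPolynomial (Fin 3) R), ∀ i, extIdeal (S i) J = K i := by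
  classical
  have := Fintype.ofFinite ι
  refine ⟨⨅ i, (K i).comap (MvPolynomial.map (algebraMap R (S i))), fun i => le_antisymm ?_ ?_⟩
  · exact Ideal.map_le_iff_le_comap.2 (iInf_le _ i)
  · intro f hf
    obtain ⟨d, hd, g, hg⟩ := exists_map_eq (Submonoid.powers (h i)) (S i) f
    have hgK : MvPolynomial.map (algebraMap R (S i)) g ∈ K i := by
      rw [hg]
      exact Ideal.mul_mem_left _ _ hf
    choose m hm using fun j => H i j g hgK
    have hJ : MvPolynomial.C (h i ^ (∑ j, m j)) * g ∈
        ⨅ j, (K j).comap (MvPolynomial.map (algebraMap R (S j))) := by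
      rw [Ideal.mem_iInf]
      intro j
      rw [Ideal.mem_comap, ← Finset.sum_erase_add _ _ (Finset.mem_univ j), pow_add,
        MvPolynomial.C_mul, mul_assoc, map_mul]
      exact Ideal.mul_mem_left _ _ (hm j)
    have h1 : MvPolynomial.map (algebraMap R (S i)) (MvPolynomial.C (h i ^ (∑ j, m j)) * g) ∈
        extIdeal (S i) (⨅ j, (K j).comap (MvPolynomial.map (algebraMap R (S j)))) :=
      Ideal.mem_map_of_mem _ hJ
    rw [map_mul, hg, MvPolynomial.map_C, ← mul_assoc, ← map_mul, ← map_mul] at h1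
    have hu : IsUnit (algebraMap R (S i) (h i ^ (∑ j, m j) * d)) := by
      obtain ⟨e, rfl⟩ := hd
      exact IsLocalization.map_units (S i)
        (⟨h i ^ (∑ j, m j) * h i ^ e, _, pow_add (h i) _ _⟩ : Submonoid.powers (h i))
    exact (Ideal.unit_mul_mem_iff_mem _ (hu.map MvPolynomial.C)).1 h1

end localization

/-! ### Ideals of finite length are locally described by triples -/

section length

variable {n : ℕ} {R : Type*} [CommRing R]

/-- Multiplication by the variables on a quotient with a basis gives a framed triple. -/
lemma exists_describes_of_equiv {J : Ideal (MvPolynomial (Fin 3) R)}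
    (φ : (MvPolynomial (Fin 3) R ⧸ J) ≃ₗ[R] (Fin n → R)) :
    ∃ t : FramedTriple n R, Describes t J := by
  refine ⟨⟨fun i => LinearMap.toMatrix' (φ.toLinearMap ∘ₗ
    LinearMap.mulLeft R (Ideal.Quotient.mk J (MvPolynomial.X i)) ∘ₗ φ.symm.toLinearMap), φ 1⟩,
    φ, rfl, fun i m => ?_⟩
  rw [← Matrix.toLin'_apply, Matrix.toLin'_toMatrix']
  simp

lemma IsLengthIdeal.exists_describes {J : Ideal (MvPolynomial (Fin 3) R)} (hJ : IsLengthIdeal n J)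
    (x : PrimeSpectrum R) : ∃ h ∉ x.asIdeal, ∃ t : FramedTriple n (Localization.Away h),
      Describes t (extIdeal (Localization.Away h) J) := by
  have := hJ.finite
  have := hJ.projective
  have := Module.finitePresentation_of_projective R (MvPolynomial (Fin 3) R ⧸ J)
  let M := LocalizedModule x.asIdeal.primeCompl (MvPolynomial (Fin 3) R ⧸ J)
  have : Module.Free (Localization.AtPrime x.asIdeal) M := Module.free_of_flat_of_isLocalRing
  have hn : Module.finrank (Localization.AtPrime x.asIdeal) M = n := hJ.rank x
  obtain ⟨h, hx, b, -⟩ := Module.FinitePresentation.exists_basis_localizedModule_powers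
    x.asIdeal.primeCompl (LocalizedModule.mkLinearMap x.asIdeal.primeCompl _)
    (Localization.AtPrime x.asIdeal) (Module.finBasisOfFinrankEq _ M hn)
  refine ⟨h, hx, ?_⟩
  have := isLocalizedModule_quotExt (Submonoid.powers h) (Localization.Away h) J
  let e := (IsLocalizedModule.iso (Submonoid.powers h)
    (quotExt (Localization.Away h) J)).extendScalarsOfIsLocalization (Submonoid.powers h)
    (Localization.Away h)
  exact exists_describes_of_equiv (e.symm ≪≫ₗ b.equivFun)

/-- An ideal that is locally described by framed triples has length `n`. -/
lemma isLengthIdeal_of_describes {J : Ideal (MvPolynomial (Fin 3) R)}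
    (hJ : ∀ x : PrimeSpectrum R, ∃ h ∉ x.asIdeal, ∃ t : FramedTriple n (Localization.Away h),
      Describes t (extIdeal (Localization.Away h) J)) : IsLengthIdeal n J := by
  let s : Set R := {h | ∃ t : FramedTriple n (Localization.Away h),
      Describes t (extIdeal (Localization.Away h) J)}
  have hs : Ideal.span s = ⊤ := by
    by_contra hne
    obtain ⟨m, hm, hle⟩ := Ideal.exists_le_maximal _ hne
    obtain ⟨h, hx, ht⟩ := hJ ⟨m, hm.isPrime⟩
    exact hx (hle (Ideal.subset_span ht))
  have hloc : ∀ h : R, IsLocalizedModule (Submonoid.powers h) (quotExt (Localization.Away h) J) :=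
    fun h => isLocalizedModule_quotExt (Submonoid.powers h) (Localization.Away h) J
  have : Module.FinitePresentation R (MvPolynomial (Fin 3) R ⧸ J) := by
    refine Module.FinitePresentation.of_localizationSpan' s hs
      (Rₚ := fun g => Localization.Away g.1)
      (fun g => quotExt (Localization.Away g.1) J) fun g => ?_
    obtain ⟨t, φ, -⟩ := g.2
    exact Module.FinitePresentation.of_equiv φ.symm
  have hproj : Module.Projective R (MvPolynomial (Fin 3) R ⧸ J) := by
    rw [← Module.freeLocus_eq_univ_iff, Set.eq_univ_iff_forall]
    intro x
    obtain ⟨h, hx, t, φ, -⟩ := hJ x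
    refine Module.basicOpen_subset_freeLocus_iff.2 ?_ hx
    let e := (IsLocalizedModule.iso (Submonoid.powers h)
      (quotExt (Localization.Away h) J)).extendScalarsOfIsLocalization (Submonoid.powers h)
      (Localization.Away h)
    exact Module.Projective.of_equiv (e ≪≫ₗ φ).symm
  refine ⟨inferInstance, hproj, fun x => ?_⟩
  obtain ⟨h, hx, t, φ, -⟩ := hJ x
  have hx' : x ∈ Set.range (PrimeSpectrum.comap (algebraMap R (Localization.Away h))) := by
    rw [PrimeSpectrum.localization_away_comap_range _ h]
    exact hx
  obtain ⟨y, rfl⟩ := hx'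
  have hbc : IsBaseChange (Localization.Away h) (quotExt (Localization.Away h) J) :=
    (isLocalizedModule_iff_isBaseChange (Submonoid.powers h) _ _).1 (hloc h)
  rw [← Module.rankAtStalk_isBaseChange hbc, Module.rankAtStalk_eq_of_equiv φ,
    Module.rankAtStalk_eq_finrank_of_free]
  have := y.nontrivial
  simp

end length
end HilbCrit

namespace HilbCrit

/-! ### Ring-valued points form a Zariski sheaf -/

section sheaf

open Limits TensorProduct

variable {k : Type u} [Field k] {H : Scheme.{u}} {s : H ⟶ Spec (CommRingCat.of k)}

namespace RingPoint

lemma map_map {R R' R'' : Type u} [CommRing R] [CommRing R'] [CommRing R''] [Algebra k R]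
    [Algebra k R'] [Algebra k R''] (φ : R →ₐ[k] R') (ψ : R' →ₐ[k] R'') (q : RingPoint s R) :
    (q.map φ).map ψ = q.map (ψ.comp φ) := by
  apply Subtype.ext
  change Spec.map _ ≫ Spec.map _ ≫ q.1 = Spec.map _ ≫ q.1
  rw [← Category.assoc, ← Spec.map_comp]
  rfl

lemma map_id {R : Type u} [CommRing R] [Algebra k R] (q : RingPoint s R) :
    q.map (AlgHom.id k R) = q := by
  apply Subtype.ext
  change Spec.map (𝟙 _) ≫ q.1 = q.1
  rw [Spec.map_id, Category.id_comp]

variable {R : Type u} [CommRing R] [Algebra k R]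

/-- The localization map of a `k`-algebra, as a homomorphism of `k`-algebras. -/
abbrev _root_.HilbCrit.awayHom (k : Type u) [Field k] {R : Type u} [CommRing R] [Algebra k R]
    (h : R) : R →ₐ[k] Localization.Away h :=
  IsScalarTower.toAlgHom k R (Localization.Away h)

variable {ι : Type u} {h : ι → R}

lemma ext_of_cover (hh : Ideal.span (Set.range h) = ⊤) {q q' : RingPoint s R}
    (H : ∀ i, q.map (awayHom k (h i)) = q'.map (awayHom k (h i))) : q = q' := by
  apply Subtype.ext
  refine Scheme.Cover.hom_ext
    (Scheme.affineOpenCoverOfSpanRangeEqTop (R := CommRingCat.of R) h hh).openCover _ _ fun i => ?_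
  exact congrArg Subtype.val (H i)

/-- Two ring points over `R`-algebras that agree over every common algebra agree on the fibre
product of the two spectra. -/
lemma pullback_fst_comp_eq {S S' : Type u} [CommRing S] [CommRing S'] [Algebra R S] [Algebra R S']
    [Algebra k S] [Algebra k S'] [IsScalarTower k R S] [IsScalarTower k R S'] {q : RingPoint s S}
    {q' : RingPoint s S'}
    (H : ∀ (R' : Type u) [CommRing R'] [Algebra k R'] (α : S →ₐ[k] R') (β : S' →ₐ[k] R'),
      α.comp (IsScalarTower.toAlgHom k R S) = β.comp (IsScalarTower.toAlgHom k R S') →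
        q.map α = q'.map β) :
    pullback.fst (Spec.map (CommRingCat.ofHom (algebraMap R S)))
        (Spec.map (CommRingCat.ofHom (algebraMap R S'))) ≫ q.1 =
      pullback.snd (Spec.map (CommRingCat.ofHom (algebraMap R S)))
        (Spec.map (CommRingCat.ofHom (algebraMap R S'))) ≫ q'.1 := by
  let α : S →ₐ[k] S ⊗[R] S' :=
    (Algebra.TensorProduct.includeLeft : S →ₐ[R] S ⊗[R] S').restrictScalars k
  let β : S' →ₐ[k] S ⊗[R] S' :=
    (Algebra.TensorProduct.includeRight : S' →ₐ[R] S ⊗[R] S').restrictScalars k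
  have h1 := H (S ⊗[R] S') α β (by
    ext r
    change α (algebraMap R S r) = β (algebraMap R S' r)
    simp [α, β])
  rw [← cancel_epi (pullbackSpecIso R S S').inv, pullbackSpecIso_inv_fst_assoc,
    pullbackSpecIso_inv_snd_assoc]
  exact congrArg Subtype.val h1

lemma exists_glue (hh : Ideal.span (Set.range h) = ⊤)
    (q : ∀ i, RingPoint s (Localization.Away (h i)))
    (H : ∀ i j (R' : Type u) [CommRing R'] [Algebra k R'] (α : Localization.Away (h i) →ₐ[k] R')
      (β : Localization.Away (h j) →ₐ[k] R'),
      α.comp (awayHom k (h i)) = β.comp (awayHom k (h j)) → (q i).map α = (q j).map β) :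
    ∃ q₀ : RingPoint s R, ∀ i, q₀.map (awayHom k (h i)) = q i := by
  let 𝒰 := (Scheme.affineOpenCoverOfSpanRangeEqTop (R := CommRingCat.of R) h hh).openCover
  have hglue := 𝒰.ι_glueMorphisms (fun i => (q i).1) fun i j => pullback_fst_comp_eq (H i j)
  refine ⟨⟨𝒰.glueMorphisms (fun i => (q i).1) fun i j => pullback_fst_comp_eq (H i j), ?_⟩,
    fun i => Subtype.ext (hglue i)⟩
  refine Scheme.Cover.hom_ext 𝒰 _ _ fun i => ?_
  refine (Category.assoc _ _ _).symm.trans ((congrArg (· ≫ s) (hglue i)).trans ?_)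
  refine (q i).2.trans (Eq.trans ?_ (Spec.map_comp _ _))
  exact congrArg Spec.map (congrArg CommRingCat.ofHom (IsScalarTower.algebraMap_eq k R _))

end RingPoint
end sheaf
end HilbCrit

namespace HilbCrit

/-! ### A quotient of commuting cyclic triples is the Hilbert scheme -/

section hilbert

variable {k : Type u} [Field k] {n : ℕ} {H : Scheme.{u}} {s : H ⟶ Spec (CommRingCat.of k)}

/-- The scheme `H` is the Zariski quotient sheaf, on `k`-algebras, of commuting cyclic framed
triples by `GL_n`; here `L q t` says that the triple `t` lifts the point `q`. -/
structure IsCommutingQuotient (s : H ⟶ Spec (CommRingCat.of k))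
    (L : ∀ {R : Type u} [CommRing R] [Algebra k R], RingPoint s R → FramedTriple n R → Prop) :
    Prop where
  exists_cover : ∀ {R : Type u} [CommRing R] [Algebra k R] (q : RingPoint s R)
    (x : PrimeSpectrum R), ∃ h ∉ x.asIdeal, ∃ t, L (q.map (awayHom k h)) t
  commute : ∀ {R : Type u} [CommRing R] [Algebra k R] {q : RingPoint s R} {t : FramedTriple n R},
    L q t → t.PairwiseCommute
  unit : ∀ {R : Type u} [CommRing R] [Algebra k R] {q : RingPoint s R} {t : FramedTriple n R},
    L q t → t.UnitWordDets
  map : ∀ {R R' : Type u} [CommRing R] [CommRing R'] [Algebra k R] [Algebra k R']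
    {q : RingPoint s R} {t : FramedTriple n R} (φ : R →ₐ[k] R'),
    L q t → L (q.map φ) (t.map φ.toRingHom)
  eq_iff : ∀ {R : Type u} [CommRing R] [Algebra k R] {q q' : RingPoint s R}
    {t t' : FramedTriple n R}, L q t → L q' t' → (q = q' ↔ ∃ g : GL (Fin n) R, t' = g • t)
  exists_lift : ∀ {R : Type u} [CommRing R] [Algebra k R] {t : FramedTriple n R},
    t.PairwiseCommute → t.UnitWordDets → ∃ q : RingPoint s R, L q t

lemma eq_of_extIdeal_eq {R : Type u} [CommRing R] {ι : Type u} {a : ι → R}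
    (ha : Ideal.span (Set.range a) = ⊤) {J J' : Ideal (MvPolynomial (Fin 3) R)}
    (h : ∀ i, extIdeal (Localization.Away (a i)) J = extIdeal (Localization.Away (a i)) J') :
    J = J' :=
  le_antisymm (le_of_extIdeal_le ha (fun i => Localization.Away (a i)) fun i => (h i).le)
    (le_of_extIdeal_le ha (fun i => Localization.Away (a i)) fun i => (h i).ge)

/-- A property that holds for some basic open neighbourhood of each point of `Spec R` holds for the
members of a finite cover by basic opens. -/
lemma exists_span_eq_top {R : Type u} [CommRing R] {P : R → Prop}
    (hP : ∀ x : PrimeSpectrum R, ∃ h ∉ x.asIdeal, P h) :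
    ∃ (ι : Type u) (_ : Finite ι) (h : ι → R), Ideal.span (Set.range h) = ⊤ ∧ ∀ i, P (h i) := by
  have hs : Ideal.span {h | P h} = ⊤ := by
    by_contra hne
    obtain ⟨m, hm, hle⟩ := Ideal.exists_le_maximal _ hne
    obtain ⟨h, hx, ht⟩ := hP ⟨m, hm.isPrime⟩
    exact hx (hle (Ideal.subset_span ht))
  obtain ⟨s', hs', htop⟩ := (Ideal.span_eq_top_iff_finite _).1 hs
  exact ⟨s', inferInstance, Subtype.val, by simpa using htop, fun i => hs' i.2⟩

/-- A homomorphism that inverts `h` extends to the localization away from `h`. -/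
lemma exists_comp_awayHom_eq {R R' : Type u} [CommRing R] [CommRing R'] [Algebra k R]
    [Algebra k R'] (φ : R →ₐ[k] R') {h : R} (hu : IsUnit (φ h)) :
    ∃ α : Localization.Away h →ₐ[k] R', α.comp (awayHom k h) = φ := by
  have hy : ∀ y : Submonoid.powers h, IsUnit (φ y) := by
    rintro ⟨_, m, rfl⟩
    change IsUnit (φ (h ^ m))
    rw [map_pow]
    exact hu.pow m
  refine ⟨IsLocalization.liftAlgHom hy, ?_⟩
  ext r
  change IsLocalization.lift _ (algebraMap R (Localization.Away h) r) = φ r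
  rw [IsLocalization.lift_eq]
  rfl

lemma map_mvPolynomial_comp {R R' R'' : Type u} [CommRing R] [CommRing R'] [CommRing R'']
    [Algebra k R] [Algebra k R'] [Algebra k R''] (φ : R →ₐ[k] R') (ψ : R' →ₐ[k] R'')
    (J : Ideal (MvPolynomial (Fin 3) R)) :
    (J.map (MvPolynomial.map φ.toRingHom)).map (MvPolynomial.map ψ.toRingHom) =
      J.map (MvPolynomial.map (ψ.comp φ).toRingHom) := by
  rw [Ideal.map_map]
  congr 1
  ext <;> simp

namespace IsCommutingQuotient

variable {L : ∀ {R : Type u} [CommRing R] [Algebra k R], RingPoint s R → FramedTriple n R → Prop}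

/-- The ideal `J` belongs to the point `q`: every lift of a base change of `q` to a triple
describes the corresponding base change of `J`. -/
def Corresponds (L : ∀ {R : Type u} [CommRing R] [Algebra k R], RingPoint s R →
    FramedTriple n R → Prop) {R : Type u} [CommRing R] [Algebra k R] (q : RingPoint s R)
    (J : Ideal (MvPolynomial (Fin 3) R)) : Prop :=
  ∀ (R' : Type u) [CommRing R'] [Algebra k R'] (φ : R →ₐ[k] R') (t : FramedTriple n R'),
    L (q.map φ) t → Describes t (J.map (MvPolynomial.map φ.toRingHom))

variable {R R' : Type u} [CommRing R] [CommRing R'] [Algebra k R] [Algebra k R']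

lemma Corresponds.map {q : RingPoint s R} {J : Ideal (MvPolynomial (Fin 3) R)}
    (h : Corresponds L q J) (φ : R →ₐ[k] R') :
    Corresponds L (q.map φ) (J.map (MvPolynomial.map φ.toRingHom)) := by
  intro R'' _ _ ψ t ht
  rw [map_mvPolynomial_comp]
  rw [RingPoint.map_map] at ht
  exact h _ _ _ ht

lemma Corresponds.describes {q : RingPoint s R} {J : Ideal (MvPolynomial (Fin 3) R)}
    (h : Corresponds L q J) {t : FramedTriple n R} (ht : L q t) : Describes t J := by
  have := h R (AlgHom.id k R) t (by rwa [RingPoint.map_id])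
  rwa [show (AlgHom.id k R).toRingHom = RingHom.id R from rfl,
    show MvPolynomial.map (RingHom.id R) = RingHom.id _ from RingHom.ext MvPolynomial.map_id,
    Ideal.map_id] at this

variable (hL : IsCommutingQuotient s L)
include hL

/-- Two lifts of the same point describe the same ideal. -/
lemma describes_of_lifts {q : RingPoint s R} {t t' : FramedTriple n R}
    {J : Ideal (MvPolynomial (Fin 3) R)} (ht : L q t) (ht' : L q t') (h : Describes t J) :
    Describes t' J := by
  obtain ⟨g, rfl⟩ := (hL.eq_iff ht ht').1 rfl
  exact h.smul g

lemma corresponds_of_describes {q : RingPoint s R} {t : FramedTriple n R}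
    {J : Ideal (MvPolynomial (Fin 3) R)} (ht : L q t) (h : Describes t J) :
    Corresponds L q J :=
  fun _ _ _ φ _ ht' => hL.describes_of_lifts (hL.map φ ht) ht' (h.map φ.toRingHom)

lemma corresponds_unique {q : RingPoint s R} {J J' : Ideal (MvPolynomial (Fin 3) R)}
    (h : Corresponds L q J) (h' : Corresponds L q J') : J = J' := by
  obtain ⟨ι, _, a, ha, hP⟩ := exists_span_eq_top (hL.exists_cover q)
  have key : ∀ i, extIdeal (Localization.Away (a i)) J = extIdeal (Localization.Away (a i)) J' := by
    intro i
    obtain ⟨t, ht⟩ := hP i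
    exact (h _ (awayHom k (a i)) t ht).unique (h' _ (awayHom k (a i)) t ht)
  exact eq_of_extIdeal_eq ha key

/-- Ideals described by lifts of two points agree wherever the points agree. -/
lemma map_eq_map {R₁ R₂ : Type u} [CommRing R₁] [CommRing R₂] [Algebra k R₁] [Algebra k R₂]
    {q₁ : RingPoint s R₁} {q₂ : RingPoint s R₂} {t₁ : FramedTriple n R₁} {t₂ : FramedTriple n R₂}
    {J₁ : Ideal (MvPolynomial (Fin 3) R₁)} {J₂ : Ideal (MvPolynomial (Fin 3) R₂)}
    (ht₁ : L q₁ t₁) (ht₂ : L q₂ t₂) (h₁ : Describes t₁ J₁) (h₂ : Describes t₂ J₂)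
    (α : R₁ →ₐ[k] R) (β : R₂ →ₐ[k] R) (hq : q₁.map α = q₂.map β) :
    J₁.map (MvPolynomial.map α.toRingHom) = J₂.map (MvPolynomial.map β.toRingHom) := by
  have h := hL.map α ht₁
  rw [hq] at h
  exact (hL.describes_of_lifts h (hL.map β ht₂) (h₁.map _)).unique (h₂.map _)

lemma exists_corresponds (q : RingPoint s R) : ∃ J, Corresponds L q J := by
  obtain ⟨ι, _, a, ha, hP⟩ := exists_span_eq_top (hL.exists_cover q)
  choose t ht using hP
  choose K hK using fun i => exists_describes (hL.commute (ht i)) (hL.unit (ht i))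
  obtain ⟨J, hJ⟩ := exists_extIdeal_eq (h := a) (fun i => Localization.Away (a i)) K (by
    intro i j f hf
    let c : Localization.Away (a j) := algebraMap R _ (a i)
    obtain ⟨α, hα⟩ := exists_comp_awayHom_eq (((awayHom k c).comp (awayHom k (a j))))
      (h := a i) (IsLocalization.Away.algebraMap_isUnit c)
    have h1 := hL.map_eq_map (ht i) (ht j) (hK i) (hK j) α (awayHom k c) (by
      rw [RingPoint.map_map, RingPoint.map_map, hα])
    have h2 : MvPolynomial.map (awayHom k c).toRingHom
        (MvPolynomial.map (algebraMap R (Localization.Away (a j))) f) ∈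
        extIdeal (Localization.Away c) (K j) := by
      have := Ideal.mem_map_of_mem (MvPolynomial.map α.toRingHom) hf
      rw [h1, MvPolynomial.map_map] at this
      rw [MvPolynomial.map_map]
      have h3 : (awayHom k c).toRingHom.comp (algebraMap R (Localization.Away (a j))) =
          α.toRingHom.comp (algebraMap R (Localization.Away (a i))) :=
        congrArg AlgHom.toRingHom hα.symm
      rw [h3]
      exact this
    obtain ⟨_, ⟨m, rfl⟩, hm⟩ := (map_mem_extIdeal_iff (Submonoid.powers c)
      (Localization.Away c)).1 h2
    refine ⟨m, ?_⟩
    rw [map_mul, MvPolynomial.map_C, map_pow]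
    exact hm)
  refine ⟨J, fun R' _ _ φ t' ht' => ?_⟩
  obtain ⟨J', hJ'⟩ := exists_describes (hL.commute ht') (hL.unit ht')
  have hspan : Ideal.span (Set.range fun i => φ (a i)) = ⊤ := by
    have := congrArg (Ideal.map φ.toRingHom) ha
    rwa [Ideal.map_span, Ideal.map_top, ← Set.range_comp] at this
  have key : ∀ i, extIdeal (Localization.Away (φ (a i))) J' =
      extIdeal (Localization.Away (φ (a i))) (J.map (MvPolynomial.map φ.toRingHom)) := by
    intro i
    obtain ⟨β, hβ⟩ := exists_comp_awayHom_eq ((awayHom k (φ (a i))).comp φ) (h := a i)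
      (IsLocalization.Away.algebraMap_isUnit (φ (a i)))
    have h1 := hL.map_eq_map ht' (ht i) hJ' (hK i) (awayHom k (φ (a i))) β (by
      rw [RingPoint.map_map, RingPoint.map_map, hβ])
    refine h1.trans ?_
    rw [← hJ i]
    refine (map_mvPolynomial_comp (awayHom k (a i)) β J).trans ?_
    rw [hβ, ← map_mvPolynomial_comp]
    rfl
  rwa [← eq_of_extIdeal_eq hspan key]

lemma Corresponds.isLengthIdeal {q : RingPoint s R} {J : Ideal (MvPolynomial (Fin 3) R)}
    (h : Corresponds L q J) : IsLengthIdeal n J := by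
  refine isLengthIdeal_of_describes fun x => ?_
  obtain ⟨a, hx, t, ht⟩ := hL.exists_cover q x
  exact ⟨a, hx, t, h _ (awayHom k a) t ht⟩

/-- A triple that describes the ideal of a point lifts the point. -/
lemma lifts_of_describes {q : RingPoint s R} {J : Ideal (MvPolynomial (Fin 3) R)}
    (h : Corresponds L q J) {t : FramedTriple n R} (ht : Describes t J) : L q t := by
  obtain ⟨q', hq'⟩ := hL.exists_lift ht.pairwiseCommute ht.unitWordDets
  suffices q' = q by rwa [← this]
  obtain ⟨ι, _, a, ha, hP⟩ := exists_span_eq_top (hL.exists_cover q)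
  refine RingPoint.ext_of_cover ha fun i => ?_
  obtain ⟨t', ht'⟩ := hP i
  exact (hL.eq_iff (hL.map (awayHom k (a i)) hq') ht').2
    ((ht.map _).exists_smul_eq (h _ _ t' ht'))

lemma eq_of_corresponds {q q' : RingPoint s R} {J : Ideal (MvPolynomial (Fin 3) R)}
    (h : Corresponds L q J) (h' : Corresponds L q' J) : q = q' := by
  obtain ⟨ι, _, a, ha, hP⟩ := exists_span_eq_top (hL.exists_cover q)
  refine RingPoint.ext_of_cover ha fun i => ?_
  obtain ⟨t, ht⟩ := hP i
  exact (hL.eq_iff ht (hL.lifts_of_describes (h'.map _) (h _ _ t ht))).2 ⟨1, (one_smul _ _).symm⟩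

lemma exists_point_corresponds {J : Ideal (MvPolynomial (Fin 3) R)} (hJ : IsLengthIdeal n J) :
    ∃ q : RingPoint s R, Corresponds L q J := by
  obtain ⟨ι, _, a, ha, hP⟩ := exists_span_eq_top hJ.exists_describes
  choose t ht using hP
  choose q hq using fun i => hL.exists_lift (ht i).pairwiseCommute (ht i).unitWordDets
  have hc : ∀ i, Corresponds L (q i) (extIdeal _ J) :=
    fun i => hL.corresponds_of_describes (hq i) (ht i)
  obtain ⟨q₀, hq₀⟩ := RingPoint.exists_glue ha q fun i j R' _ _ α β hαβ => by
    refine hL.eq_of_corresponds ((hc i).map α) ?_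
    have h1 := (hc j).map β
    have h2 := map_mvPolynomial_comp (awayHom k (a i)) α J
    have h3 := map_mvPolynomial_comp (awayHom k (a j)) β J
    rw [hαβ, ← h3] at h2
    refine Eq.subst (motive := fun I => Corresponds L _ I) ?_ h1
    exact h2.symm
  refine ⟨q₀, ?_⟩
  obtain ⟨J', hJ'⟩ := hL.exists_corresponds q₀
  have key : ∀ i, extIdeal (Localization.Away (a i)) J = extIdeal (Localization.Away (a i)) J' := by
    intro i
    have h1 := hJ'.map (awayHom k (a i))
    rw [hq₀] at h1
    exact hL.corresponds_unique (hc i) h1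
  rwa [eq_of_extIdeal_eq ha key]

/-- The quotient of commuting cyclic triples by `GL_n` is the Hilbert scheme. -/
theorem exists_hilbertSchemeStructure :
    ∃ h : HilbertSchemeStructure n s, ∀ (R : Type u) [CommRing R] [Algebra k R]
      (q : RingPoint s R) (t : FramedTriple n R), L q t → Describes t (h.toIdeal R q).1 := by
  choose J hJ using fun (R : Type u) (_ : CommRing R) (_ : Algebra k R) (q : RingPoint s R) =>
    hL.exists_corresponds q
  refine ⟨⟨fun R _ _ => Equiv.ofBijective
    (fun q => ⟨J R _ _ q, Corresponds.isLengthIdeal hL (hJ R _ _ q)⟩) ⟨?_, ?_⟩, ?_⟩, ?_⟩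
  · intro q q' h
    have h1 := hJ R _ _ q'
    rw [← show J R _ _ q = J R _ _ q' from congrArg Subtype.val h] at h1
    exact hL.eq_of_corresponds (hJ R _ _ q) h1
  · rintro ⟨I, hI⟩
    obtain ⟨q, hq⟩ := hL.exists_point_corresponds hI
    exact ⟨q, Subtype.ext (hL.corresponds_unique (hJ R _ _ q) hq)⟩
  · intro R R' _ _ _ _ φ q
    exact hL.corresponds_unique (hJ R' _ _ (q.map φ)) ((hJ R _ _ q).map φ)
  · intro R _ _ q t ht
    exact (hJ R _ _ q).describes ht

end IsCommutingQuotient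

end hilbert
end HilbCrit

namespace HilbCrit

/-! ### The critical locus of a quotient is the Hilbert scheme -/

section concrete

variable {k : Type u} [Field k] {n : ℕ} {M : Scheme.{u}} {s : M ⟶ Spec (CommRingCat.of k)}
  {π : cyclicTriples k n ⟶ M}

/-- Orbits of points with values in a ring. -/
lemma IsGLQuotient.ring_orbits (hπ : IsGLQuotient s π) {R : Type u} [CommRing R]
    {p q : Spec (CommRingCat.of R) ⟶ cyclicTriples k n}
    (h : p ≫ cyclicTriplesStr k n = q ≫ cyclicTriplesStr k n) :
    p ≫ π = q ≫ π ↔ ∃ g : GL (Fin n) R, ringPointTriple q = g • ringPointTriple p := by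
  rw [hπ.orbits _ p q h]
  constructor
  · rintro ⟨g, hg⟩
    refine ⟨Matrix.GeneralLinearGroup.map (Scheme.ΓSpecIso (CommRingCat.of R)).hom.hom g, ?_⟩
    rw [ringPointTriple, hg, FramedTriple.map_smul]
    rfl
  · rintro ⟨g, hg⟩
    refine ⟨Matrix.GeneralLinearGroup.map (Scheme.ΓSpecIso (CommRingCat.of R)).inv.hom g, ?_⟩
    rw [pointTriple_eq_ringPointTriple_map, hg, FramedTriple.map_smul,
      ← pointTriple_eq_ringPointTriple_map]

lemma pairwiseCommute_ringPointTriple_iff {R : Type u} [CommRing R]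
    (p : Spec (CommRingCat.of R) ⟶ cyclicTriples k n) :
    (ringPointTriple p).PairwiseCommute ↔ (pointTriple p).PairwiseCommute :=
  ⟨fun h => by rw [pointTriple_eq_ringPointTriple_map]; exact h.map _, fun h => h.map _⟩

/-- The critical locus is the quotient of commuting cyclic triples. -/
theorem IsGLQuotient.isCommutingQuotient (hπ : IsGLQuotient s π) {f : Γ(M, ⊤)}
    (hf : π.appTop.hom f = cyclicPotential k n) {I : M.IdealSheafData}
    (hI : IsCriticalIdealSheaf s f I) :
    IsCommutingQuotient (n := n) (I.subschemeι ≫ s) fun {R} _ _ q t =>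
      ∃ p : Spec (CommRingCat.of R) ⟶ cyclicTriples k n,
        ringPointTriple p = t ∧ q.1 ≫ I.subschemeι = p ≫ π where
  exists_cover {R _ _} q x := by
    let g := q.1 ≫ I.subschemeι
    obtain ⟨W, hx, σ, hσ⟩ := hπ.locallySplit (g x)
    obtain ⟨_, ⟨_, ⟨h, rfl⟩, rfl⟩, hxh, hle⟩ :=
      PrimeSpectrum.isBasis_basic_opens.exists_subset_of_mem_open
      (show x ∈ g ⁻¹ᵁ W from hx) (g ⁻¹ᵁ W).2
    let j := Spec.map (CommRingCat.ofHom (algebraMap R (Localization.Away h)))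
    have hr : Set.range (j ≫ g) ⊆ Set.range W.ι := by
      rw [Scheme.Opens.range_ι]
      rintro _ ⟨y, rfl⟩
      refine hle ?_
      rw [← PrimeSpectrum.localization_away_comap_range (Localization.Away h) h]
      exact ⟨y, rfl⟩
    refine ⟨h, hxh, _, IsOpenImmersion.lift W.ι (j ≫ g) hr ≫ σ, rfl, ?_⟩
    rw [Category.assoc, hσ, IsOpenImmersion.lift_fac]
    exact Category.assoc _ _ _
  commute {R _ _ q t} := by
    rintro ⟨p, rfl, hp⟩
    rw [pairwiseCommute_ringPointTriple_iff]
    exact (exists_comp_subschemeι_iff_pairwiseCommute hπ hf hI p).1 ⟨q.1, hp⟩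
  unit {R _ _ q t} := by
    rintro ⟨p, rfl, hp⟩
    exact ringPointTriple_unitWordDets p
  map {R R' _ _ _ _ q t} φ := by
    rintro ⟨p, rfl, hp⟩
    refine ⟨Spec.map (CommRingCat.ofHom φ.toRingHom) ≫ p, ringPointTriple_SpecMap_comp _ p, ?_⟩
    rw [Category.assoc, ← hp]
    exact Category.assoc _ _ _
  eq_iff {R _ _ q q' t t'} := by
    rintro ⟨p, rfl, hp⟩ ⟨p', rfl, hp'⟩
    have hs : p ≫ cyclicTriplesStr k n = p' ≫ cyclicTriplesStr k n := by
      rw [← hπ.comp_str, ← Category.assoc, ← Category.assoc, ← hp, ← hp', Category.assoc,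
        Category.assoc]
      exact q.2.trans q'.2.symm
    rw [← hπ.ring_orbits hs, ← hp, ← hp', cancel_mono]
    exact Subtype.ext_iff
  exists_lift {R _ _ t} hc hu := by
    obtain ⟨p, hp, rfl⟩ := exists_ringPoint (k := k) t hu
    obtain ⟨q, hq⟩ := (exists_comp_subschemeι_iff_pairwiseCommute hπ hf hI p).2
      ((pairwiseCommute_ringPointTriple_iff p).1 hc)
    refine ⟨⟨q, ?_⟩, p, rfl, hq⟩
    rw [← Category.assoc, hq, Category.assoc, hπ.comp_str, hp]

end concrete
end HilbCrit

namespace HilbCrit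

/-! ### Conjugate points and slices for the action of the general linear group -/

section slice

open Limits

variable {k : Type u} [Field k] {n : ℕ} {T T' : Scheme.{u}}

/-- Two `T`-valued points of the scheme of cyclic triples, over the same structure morphism, are
conjugate under `GL_n(T)`. -/
def PointConj (p q : T ⟶ cyclicTriples k n) : Prop :=
  p ≫ cyclicTriplesStr k n = q ≫ cyclicTriplesStr k n ∧
    ∃ g : GL (Fin n) Γ(T, ⊤), pointTriple q = g • pointTriple p

namespace PointConj

lemma refl (p : T ⟶ cyclicTriples k n) : PointConj p p := ⟨rfl, 1, (one_smul _ _).symm⟩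

lemma symm {p q : T ⟶ cyclicTriples k n} (h : PointConj p q) : PointConj q p := by
  obtain ⟨hs, g, hg⟩ := h
  exact ⟨hs.symm, g⁻¹, by rw [hg, inv_smul_smul]⟩

lemma trans {p q r : T ⟶ cyclicTriples k n} (h : PointConj p q) (h' : PointConj q r) :
    PointConj p r := by
  obtain ⟨hs, g, hg⟩ := h
  obtain ⟨hs', g', hg'⟩ := h'
  exact ⟨hs.trans hs', g' * g, by rw [hg', hg, mul_smul]⟩

lemma comp {p q : T ⟶ cyclicTriples k n} (h : PointConj p q) (a : T' ⟶ T) :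
    PointConj (a ≫ p) (a ≫ q) := by
  obtain ⟨hs, g, hg⟩ := h
  refine ⟨by rw [Category.assoc, hs, Category.assoc],
    Matrix.GeneralLinearGroup.map a.appTop.hom g, ?_⟩
  rw [pointTriple_comp, hg, FramedTriple.map_smul, pointTriple_comp]

lemma isUnit_wordDet {p q : T ⟶ cyclicTriples k n} (h : PointConj p q)
    {f : Fin n → List (Fin 3)} (hu : IsUnit ((pointTriple p).wordDet f)) :
    IsUnit ((pointTriple q).wordDet f) := by
  obtain ⟨-, g, hg⟩ := h
  rw [hg, FramedTriple.wordDet_smul]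
  exact ((Matrix.isUnit_iff_isUnit_det _).1 g.isUnit).mul hu

end PointConj

/-- The ideal of the locus where a given list of words, applied to the vector, is the standard
basis. -/
def sliceIdeal (k : Type u) [Field k] {n : ℕ} (f : Fin n → List (Fin 3)) :
    Ideal (MvPolynomial (Coord n) k) :=
  Ideal.span (Set.range fun c : Fin n × Fin n => ((generic k n).wordMatrix f - 1) c.1 c.2)

lemma sliceIdeal_le_ker_iff {S : Type*} [CommRing S] (f : Fin n → List (Fin 3))
    (φ : MvPolynomial (Coord n) k →+* S) :
    sliceIdeal k f ≤ RingHom.ker φ ↔ ((generic k n).map φ).wordMatrix f = 1 := by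
  rw [sliceIdeal, Ideal.span_le, Set.range_subset_iff, FramedTriple.wordMatrix_map,
    ← Matrix.ext_iff]
  have : ∀ a b, φ ((1 : Matrix (Fin n) (Fin n) (MvPolynomial (Coord n) k)) a b) =
      (1 : Matrix (Fin n) (Fin n) S) a b := by
    intro a b
    rw [← Matrix.map_apply (f := φ), Matrix.map_one _ φ.map_zero φ.map_one]
  simp [Prod.forall, RingHom.mem_ker, sub_eq_zero, this]

/-- The slice of the action: the closed subscheme of cyclic triples for which given words, applied
to the vector, form the standard basis. Every triple with invertible word determinant is conjugate
to a unique one in the slice. -/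
abbrev slice (k : Type u) [Field k] {n : ℕ} (f : Fin n → List (Fin 3)) : Scheme.{u} :=
  pullback (cyclicLocus k n).ι
    (Spec.map (CommRingCat.ofHom (Ideal.Quotient.mk (sliceIdeal k f))))

/-- The inclusion of the slice. -/
def sliceι (k : Type u) [Field k] {n : ℕ} (f : Fin n → List (Fin 3)) :
    slice k f ⟶ cyclicTriples k n :=
  pullback.fst _ _

instance (f : Fin n → List (Fin 3)) : Mono (sliceι k f) := by
  have : IsClosedImmersion
      (Spec.map (CommRingCat.ofHom (Ideal.Quotient.mk (sliceIdeal k f)))) :=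
    IsClosedImmersion.spec_of_surjective _ Ideal.Quotient.mk_surjective
  have : Mono (Spec.map (CommRingCat.ofHom (Ideal.Quotient.mk (sliceIdeal k f)))) :=
    inferInstance
  exact pullback.fst_of_mono

lemma wordMatrix_comp_sliceι {f : Fin n → List (Fin 3)} (a : T ⟶ slice k f) :
    (pointTriple (a ≫ sliceι k f)).wordMatrix f = 1 := by
  rw [pointTriple_def, ← sliceIdeal_le_ker_iff, Category.assoc, sliceι, pullback.condition,
    ← Category.assoc, specHom_comp_SpecMap]
  intro x hx
  rw [RingHom.mem_ker, RingHom.comp_apply]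
  refine (congrArg _ (Ideal.Quotient.eq_zero_iff_mem.2 hx)).trans (map_zero _)

lemma isUnit_wordDet_comp_sliceι {f : Fin n → List (Fin 3)} (a : T ⟶ slice k f) :
    IsUnit ((pointTriple (a ≫ sliceι k f)).wordDet f) := by
  rw [← FramedTriple.det_wordMatrix, wordMatrix_comp_sliceι, Matrix.det_one]
  exact isUnit_one

lemma exists_comp_sliceι_eq {f : Fin n → List (Fin 3)} (p : T ⟶ cyclicTriples k n)
    (hp : (pointTriple p).wordMatrix f = 1) : ∃ a : T ⟶ slice k f, a ≫ sliceι k f = p := by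
  rw [pointTriple_def, ← sliceIdeal_le_ker_iff] at hp
  let ψ : CommRingCat.of (MvPolynomial (Coord n) k ⧸ sliceIdeal k f) ⟶ Γ(T, ⊤) :=
    CommRingCat.ofHom (Ideal.Quotient.lift _ (specHom (p ≫ (cyclicLocus k n).ι)) hp)
  refine ⟨pullback.lift p (T.toSpecΓ ≫ Spec.map ψ) ?_, pullback.lift_fst _ _ _⟩
  apply specHom_ext
  rw [specHom_comp_SpecMap, specHom_toSpecΓ]
  exact (Ideal.Quotient.lift_comp_mk _ _ _).symm

/-- Conjugate points of a slice are equal. -/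
lemma PointConj.slice_eq {f : Fin n → List (Fin 3)} {a b : T ⟶ slice k f}
    (h : PointConj (a ≫ sliceι k f) (b ≫ sliceι k f)) : a = b := by
  obtain ⟨hs, g, hg⟩ := h
  have h1 := wordMatrix_comp_sliceι b
  rw [hg, FramedTriple.wordMatrix_smul, wordMatrix_comp_sliceι, Matrix.mul_one] at h1
  have h2 : g = 1 := Units.ext h1
  rw [h2, one_smul] at hg
  rw [← cancel_mono (sliceι k f)]
  exact point_ext hs hg.symm

/-- A point with invertible word determinant is conjugate to a point of the slice. -/
lemma exists_slice_pointConj {f : Fin n → List (Fin 3)} {p : T ⟶ cyclicTriples k n}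
    (hu : IsUnit ((pointTriple p).wordDet f)) :
    ∃ a : T ⟶ slice k f, PointConj (a ≫ sliceι k f) p := by
  have hW : IsUnit ((pointTriple p).wordMatrix f) := (Matrix.isUnit_iff_isUnit_det _).2 hu
  obtain ⟨W, hW⟩ := hW
  let g : GL (Fin n) Γ(T, ⊤) := W⁻¹
  have h1 : (g • pointTriple p).wordMatrix f = 1 := by
    rw [FramedTriple.wordMatrix_smul, ← hW, ← Units.val_mul, inv_mul_cancel, Units.val_one]
  obtain ⟨q, hq, hqt⟩ := exists_point (p ≫ cyclicTriplesStr k n) (g • pointTriple p) fun x => by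
    refine ⟨f, ?_⟩
    rw [← FramedTriple.det_wordMatrix, h1, Matrix.det_one, Scheme.basicOpen_of_isUnit _ isUnit_one]
    trivial
  obtain ⟨a, rfl⟩ := exists_comp_sliceι_eq (f := f) q (by rw [hqt, h1])
  exact ⟨a, PointConj.symm ⟨hq.symm, g, hqt⟩⟩

/-- A morphism along which a function becomes invertible factors through its basic open subset. -/
lemma exists_comp_basicOpen_ι_eq {X : Scheme.{u}} {r : Γ(X, ⊤)} {a : T ⟶ X}
    (hu : IsUnit (a.appTop.hom r)) : ∃ b : T ⟶ (X.basicOpen r).toScheme,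
      b ≫ (X.basicOpen r).ι = a := by
  have h1 : a ⁻¹ᵁ X.basicOpen r = ⊤ := by
    rw [Scheme.preimage_basicOpen_top]
    exact Scheme.basicOpen_of_isUnit _ hu
  refine ⟨IsOpenImmersion.lift (X.basicOpen r).ι a ?_, IsOpenImmersion.lift_fac _ _ _⟩
  rw [Scheme.Opens.range_ι]
  rintro _ ⟨x, rfl⟩
  have : x ∈ a ⁻¹ᵁ X.basicOpen r := h1 ▸ trivial
  exact this

lemma isUnit_ι_appTop_basicOpen {X : Scheme.{u}} {r : Γ(X, ⊤)} {V : X.Opens}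
    (hV : V ≤ X.basicOpen r) : IsUnit (V.ι.appTop.hom r) := by
  have h1 : IsUnit (X.presheaf.map (homOfLE (X.basicOpen_le r)).op r) :=
    X.toRingedSpace.isUnit_res_basicOpen r
  have h2 : X.presheaf.map (homOfLE (X.basicOpen_le r)).op ≫ X.presheaf.map (homOfLE hV).op =
      V.ι.appTop ≫ V.topIso.hom :=
    (X.presheaf.map_comp _ _).symm.trans (ι_appTop_comp_topIso_hom V).symm
  have h3 : IsUnit (V.topIso.hom.hom (V.ι.appTop.hom r)) := by
    have := h1.map (X.presheaf.map (homOfLE hV).op).hom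
    rwa [show (X.presheaf.map (homOfLE hV).op).hom (X.presheaf.map (homOfLE
      (X.basicOpen_le r)).op r) = _ from RingHom.congr_fun (congrArg CommRingCat.Hom.hom h2) r]
      at this
  exact (MulEquiv.isUnit_map V.topIso.commRingCatIsoToRingEquiv).1 h3

end slice
end HilbCrit

namespace HilbCrit

/-! ### Gluing the slices -/

section glue

open Limits

variable (k : Type u) [Field k] {n : ℕ} {T T' : Scheme.{u}}

/-- The open subscheme of the slice of `f` whose points are conjugate to points in the slice of
`f'`. -/
def sliceInter (f f' : Fin n → List (Fin 3)) : (slice k f).Opens :=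
  (slice k f).basicOpen ((pointTriple (sliceι k f)).wordDet f')

/-- The inclusion of `sliceInter` into the scheme of cyclic triples. -/
abbrev sliceInterι (f f' : Fin n → List (Fin 3)) :
    (sliceInter k f f').toScheme ⟶ cyclicTriples k n :=
  (sliceInter k f f').ι ≫ sliceι k f

variable {k} {f f' f'' : Fin n → List (Fin 3)}

lemma exists_comp_sliceInter_ι_eq {a : T ⟶ slice k f}
    (hu : IsUnit ((pointTriple (a ≫ sliceι k f)).wordDet f')) :
    ∃ b : T ⟶ (sliceInter k f f').toScheme, b ≫ (sliceInter k f f').ι = a := by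
  rw [pointTriple_comp, FramedTriple.wordDet_map] at hu
  exact exists_comp_basicOpen_ι_eq hu

lemma isUnit_wordDet_comp_sliceInterι (b : T ⟶ (sliceInter k f f').toScheme) :
    IsUnit ((pointTriple (b ≫ sliceInterι k f f')).wordDet f') := by
  rw [pointTriple_comp, pointTriple_comp, FramedTriple.wordDet_map, FramedTriple.wordDet_map]
  exact (isUnit_ι_appTop_basicOpen le_rfl).map _

lemma PointConj.sliceInter_eq {b b' : T ⟶ (sliceInter k f f').toScheme}
    (h : PointConj (b ≫ sliceInterι k f f') (b' ≫ sliceInterι k f f')) : b = b' := by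
  rw [← cancel_mono (sliceInter k f f').ι]
  apply PointConj.slice_eq
  rwa [Category.assoc, Category.assoc]

lemma exists_sliceInter_pointConj (b : T ⟶ (sliceInter k f f').toScheme) :
    ∃ c : T ⟶ (sliceInter k f' f).toScheme,
      PointConj (c ≫ sliceInterι k f' f) (b ≫ sliceInterι k f f') := by
  obtain ⟨a, ha⟩ := exists_slice_pointConj (isUnit_wordDet_comp_sliceInterι b)
  have hu : IsUnit ((pointTriple (a ≫ sliceι k f')).wordDet f) := by
    refine ha.symm.isUnit_wordDet ?_
    rw [← Category.assoc]
    exact isUnit_wordDet_comp_sliceι _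
  obtain ⟨c, rfl⟩ := exists_comp_sliceInter_ι_eq hu
  exact ⟨c, by rwa [Category.assoc] at ha⟩

variable (k) in
lemma exists_sliceTransition (f f' : Fin n → List (Fin 3)) :
    ∃ t : (sliceInter k f f').toScheme ⟶ (sliceInter k f' f).toScheme,
      PointConj (t ≫ sliceInterι k f' f) (sliceInterι k f f') := by
  obtain ⟨t, ht⟩ := exists_sliceInter_pointConj (𝟙 (sliceInter k f f').toScheme)
  exact ⟨t, by rwa [Category.id_comp] at ht⟩

variable (k) in
/-- The transition map between two slices, characterized by carrying every point to a conjugate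
point. -/
def sliceTransition (f f' : Fin n → List (Fin 3)) :
    (sliceInter k f f').toScheme ⟶ (sliceInter k f' f).toScheme :=
  (exists_sliceTransition k f f').choose

lemma sliceTransition_pointConj (b : T ⟶ (sliceInter k f f').toScheme) :
    PointConj (b ≫ sliceTransition k f f' ≫ sliceInterι k f' f) (b ≫ sliceInterι k f f') :=
  (exists_sliceTransition k f f').choose_spec.comp b

lemma isIso_ι_of_eq_top {X : Scheme.{u}} {U : X.Opens} (h : U = ⊤) : IsIso U.ι := by
  subst h
  exact X.topIso.isIso_hom

lemma sliceTransition_self : sliceTransition k f f = 𝟙 _ := by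
  apply PointConj.sliceInter_eq
  have := sliceTransition_pointConj (𝟙 (sliceInter k f f).toScheme)
  rwa [Category.id_comp] at this

variable (k) in
lemma exists_sliceTransition_triple (f f' f'' : Fin n → List (Fin 3)) :
    ∃ t : pullback (sliceInter k f f').ι (sliceInter k f f'').ι ⟶
      pullback (sliceInter k f' f'').ι (sliceInter k f' f).ι,
      t ≫ pullback.snd _ _ = pullback.fst _ _ ≫ sliceTransition k f f' := by
  let P := pullback (sliceInter k f f').ι (sliceInter k f f'').ι
  let b : P ⟶ (sliceInter k f f').toScheme := pullback.fst _ _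
  let c : P ⟶ (sliceInter k f f'').toScheme := pullback.snd _ _
  have hbc : b ≫ sliceInterι k f f' = c ≫ sliceInterι k f f'' := by
    simp only [b, c, sliceInterι, ← Category.assoc, pullback.condition]
  have hu : IsUnit ((pointTriple
      ((b ≫ sliceTransition k f f' ≫ (sliceInter k f' f).ι) ≫ sliceι k f')).wordDet f'') := by
    have h1 := (sliceTransition_pointConj b).symm
    rw [hbc] at h1
    simpa only [Category.assoc] using h1.isUnit_wordDet (isUnit_wordDet_comp_sliceInterι c)
  obtain ⟨d, hd⟩ := exists_comp_sliceInter_ι_eq hu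
  exact ⟨pullback.lift d (b ≫ sliceTransition k f f') (by rw [hd, Category.assoc]),
    pullback.lift_snd _ _ _⟩

variable (k) in
/-- The transition map on triple intersections of slices. -/
def sliceTransitionTriple (f f' f'' : Fin n → List (Fin 3)) :
    pullback (sliceInter k f f').ι (sliceInter k f f'').ι ⟶
      pullback (sliceInter k f' f'').ι (sliceInter k f' f).ι :=
  (exists_sliceTransition_triple k f f' f'').choose

lemma sliceTransitionTriple_snd : sliceTransitionTriple k f f' f'' ≫ pullback.snd _ _ =
    pullback.fst _ _ ≫ sliceTransition k f f' :=
  (exists_sliceTransition_triple k f f' f'').choose_spec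

lemma sliceTransitionTriple_pointConj
    (b : T ⟶ pullback (sliceInter k f f').ι (sliceInter k f f'').ι) :
    PointConj (b ≫ sliceTransitionTriple k f f' f'' ≫ pullback.fst _ _ ≫ sliceInterι k f' f'')
      (b ≫ pullback.fst _ _ ≫ sliceInterι k f f') := by
  have h1 : sliceTransitionTriple k f f' f'' ≫ pullback.fst _ _ ≫ sliceInterι k f' f'' =
      pullback.fst _ _ ≫ sliceTransition k f f' ≫ sliceInterι k f' f := by
    rw [← Category.assoc (pullback.fst _ _) (sliceTransition k f f'), ← sliceTransitionTriple_snd,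
      Category.assoc]
    simp only [sliceInterι]
    rw [pullback.condition_assoc]
  rw [h1]
  have h2 := sliceTransition_pointConj (b ≫ pullback.fst _ _)
  rwa [Category.assoc, Category.assoc] at h2

variable (k n) in
/-- The gluing data for the quotient of the scheme of cyclic triples by the general linear group:
the slices, indexed by `n`-tuples of words, glued along conjugation of points. -/
def quotientGlueData : Scheme.GlueData.{u} where
  J := ULift.{u} (Fin n → List (Fin 3))
  U f := slice k f.down
  V c := (sliceInter k c.1.down c.2.down).toScheme
  f f f' := (sliceInter k f.down f'.down).ι
  f_id f := by
    have : sliceInter k f.down f.down = ⊤ := by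
      have h := isUnit_wordDet_comp_sliceι (𝟙 (slice k f.down))
      rw [Category.id_comp] at h
      exact Scheme.basicOpen_of_isUnit _ h
    exact isIso_ι_of_eq_top this
  t f f' := sliceTransition k f.down f'.down
  t_id f := sliceTransition_self
  t' f f' f'' := sliceTransitionTriple k f.down f'.down f''.down
  t_fac f f' f'' := sliceTransitionTriple_snd
  cocycle f f' f'' := by
    rw [← cancel_mono (pullback.fst _ _)]
    apply PointConj.sliceInter_eq
    rw [Category.id_comp]
    have h1 := sliceTransitionTriple_pointConj
      (𝟙 (pullback (sliceInter k f.down f'.down).ι (sliceInter k f.down f''.down).ι))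
    have h2 := sliceTransitionTriple_pointConj
      (sliceTransitionTriple k f.down f'.down f''.down)
    have h3 := sliceTransitionTriple_pointConj
      (sliceTransitionTriple k f.down f'.down f''.down ≫
        sliceTransitionTriple k f'.down f''.down f.down)
    simp only [Category.assoc, Category.id_comp] at h1 h2 h3 ⊢
    exact (h3.trans h2).trans h1
  f_open f f' := inferInstance

end glue
end HilbCrit

namespace HilbCrit

/-! ### Gluing conjugations -/

section conj

variable {k : Type u} [Field k] {n : ℕ} {T : Scheme.{u}} {ι : Type*} {W : ι → T.Opens}

lemma function_eq_of_cover (hW : ∀ x, ∃ i, x ∈ W i) {f g : Γ(T, ⊤)}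
    (h : ∀ i, (W i).ι.appTop.hom f = (W i).ι.appTop.hom g) : f = g := by
  have hc : ∀ i j,
      (T.homOfLE (inf_le_left : W i ⊓ W j ≤ W i)).appTop.hom ((W i).ι.appTop.hom g) =
        (T.homOfLE (inf_le_right : W i ⊓ W j ≤ W j)).appTop.hom ((W j).ι.appTop.hom g) := by
    intro i j
    have h1 : T.homOfLE (inf_le_left : W i ⊓ W j ≤ W i) ≫ (W i).ι =
        T.homOfLE (inf_le_right : W i ⊓ W j ≤ W j) ≫ (W j).ι := by
      rw [Scheme.homOfLE_ι, Scheme.homOfLE_ι]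
    have h2 := congrArg Scheme.Hom.appTop h1
    rw [Scheme.Hom.comp_appTop, Scheme.Hom.comp_appTop] at h2
    exact RingHom.congr_fun (congrArg CommRingCat.Hom.hom h2) g
  obtain ⟨F, -, hF⟩ := existsUnique_glue_function W hW _ hc
  exact (hF f h).trans (hF g fun _ => rfl).symm

lemma matrix_eq_of_cover (hW : ∀ x, ∃ i, x ∈ W i) {X Y : Matrix (Fin n) (Fin n) Γ(T, ⊤)}
    (h : ∀ i, X.map (W i).ι.appTop.hom = Y.map (W i).ι.appTop.hom) : X = Y := by
  ext a b
  exact function_eq_of_cover hW fun i => congrFun (congrFun (h i) a) b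

lemma FramedTriple.eq_of_cover (hW : ∀ x, ∃ i, x ∈ W i) {t t' : FramedTriple n Γ(T, ⊤)}
    (h : ∀ i, t.map (W i).ι.appTop.hom = t'.map (W i).ι.appTop.hom) : t = t' := by
  apply FramedTriple.ext
  · funext j
    exact matrix_eq_of_cover hW fun i => congrArg (fun t => A t j) (h i)
  · funext j
    exact function_eq_of_cover hW fun i => congrArg (fun t => v t j) (h i)

/-- Cyclic triples have trivial stabilizers. -/
lemma eq_of_smul_pointTriple_eq {p : T ⟶ cyclicTriples k n} {g g' : GL (Fin n) Γ(T, ⊤)}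
    (h : g • pointTriple p = g' • pointTriple p) : g = g' := by
  choose f hf using exists_mem_basicOpen_wordDet p
  apply Units.ext
  refine matrix_eq_of_cover (fun x => ⟨x, hf x⟩) fun x => ?_
  let ρ := (T.basicOpen ((pointTriple p).wordDet (f x))).ι.appTop.hom
  have hu : IsUnit (((pointTriple p).map ρ).wordDet (f x)) := by
    rw [FramedTriple.wordDet_map]
    exact isUnit_ι_appTop_basicOpen le_rfl
  have h1 := congrArg (FramedTriple.map ρ) h
  rw [FramedTriple.map_smul, FramedTriple.map_smul] at h1
  refine FramedTriple.matrix_ext_of_isUnit hu fun w => ?_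
  have h2 := congrArg (fun t => FramedTriple.word t w) h1
  simp only [FramedTriple.word_smul] at h2
  exact h2

lemma exists_matrix_of_cover (hW : ∀ x, ∃ i, x ∈ W i)
    (X : ∀ i, Matrix (Fin n) (Fin n) Γ((W i).toScheme, ⊤))
    (hX : ∀ i j, (X i).map (T.homOfLE (inf_le_left : W i ⊓ W j ≤ W i)).appTop.hom =
      (X j).map (T.homOfLE (inf_le_right : W i ⊓ W j ≤ W j)).appTop.hom) :
    ∃ Y : Matrix (Fin n) (Fin n) Γ(T, ⊤), ∀ i, Y.map (W i).ι.appTop.hom = X i := by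
  choose Y hY using fun a b => (existsUnique_glue_function W hW (fun i => X i a b)
    fun i j => congrFun (congrFun (hX i j) a) b).exists
  exact ⟨Matrix.of Y, fun i => by ext a b; exact hY a b i⟩

/-- Points that are locally conjugate are conjugate, because the conjugating matrix is unique. -/
lemma PointConj.of_cover (hW : ∀ x, ∃ i, x ∈ W i) {p q : T ⟶ cyclicTriples k n}
    (h : ∀ i, PointConj ((W i).ι ≫ p) ((W i).ι ≫ q)) : PointConj p q := by
  refine ⟨Scheme.hom_ext_of_forall _ _ fun x => ?_, ?_⟩
  · obtain ⟨i, hi⟩ := hW x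
    exact ⟨W i, hi, by simpa only [Category.assoc] using (h i).1⟩
  choose g hg using fun i => (h i).2
  have hcompat : ∀ i j,
      GeneralLinearGroup.map (T.homOfLE (inf_le_left : W i ⊓ W j ≤ W i)).appTop.hom (g i) =
        GeneralLinearGroup.map (T.homOfLE (inf_le_right : W i ⊓ W j ≤ W j)).appTop.hom (g j) := by
    intro i j
    apply eq_of_smul_pointTriple_eq (p := (W i ⊓ W j).ι ≫ p)
    have key : ∀ l (hl : W i ⊓ W j ≤ W l), pointTriple ((W i ⊓ W j).ι ≫ q) =
        GeneralLinearGroup.map (T.homOfLE hl).appTop.hom (g l) •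
          pointTriple ((W i ⊓ W j).ι ≫ p) := by
      intro l hl
      rw [← Scheme.homOfLE_ι T hl, Category.assoc, pointTriple_comp, hg, FramedTriple.map_smul,
        ← pointTriple_comp, Category.assoc]
    rw [← key i inf_le_left, ← key j inf_le_right]
  obtain ⟨G, hG⟩ := exists_matrix_of_cover hW (fun i => (g i).val) fun i j =>
    congrArg Units.val (hcompat i j)
  obtain ⟨G', hG'⟩ := exists_matrix_of_cover hW (fun i => (g i)⁻¹.val) fun i j =>
    congrArg (fun γ : GL (Fin n) Γ((W i ⊓ W j).toScheme, ⊤) => γ⁻¹.val) (hcompat i j)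
  have hone : ∀ i, (1 : Matrix (Fin n) (Fin n) Γ(T, ⊤)).map (W i).ι.appTop.hom = 1 :=
    fun i => Matrix.map_one _ (map_zero _) (map_one _)
  let γ : GL (Fin n) Γ(T, ⊤) := ⟨G, G',
    matrix_eq_of_cover hW fun i => by
      rw [Matrix.map_mul, hG, hG', hone, ← Units.val_mul, mul_inv_cancel, Units.val_one],
    matrix_eq_of_cover hW fun i => by
      rw [Matrix.map_mul, hG, hG', hone, ← Units.val_mul, inv_mul_cancel, Units.val_one]⟩
  refine ⟨γ, FramedTriple.eq_of_cover hW fun i => ?_⟩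
  have hγ : GeneralLinearGroup.map (W i).ι.appTop.hom γ = g i := Units.ext (hG i)
  rw [FramedTriple.map_smul, hγ, ← pointTriple_comp, ← pointTriple_comp, hg]

end conj

/-! ### The quotient of the scheme of cyclic triples -/

section quotient

open Limits

variable (k : Type u) [Field k] {n : ℕ} {T : Scheme.{u}} {f f' : Fin n → List (Fin 3)}

/-- The inclusion of a slice into the quotient. -/
def sliceToQuotient (f : Fin n → List (Fin 3)) : slice k f ⟶ (quotientGlueData k n).glued :=
  (quotientGlueData k n).ι ⟨f⟩

instance (f : Fin n → List (Fin 3)) : IsOpenImmersion (sliceToQuotient k f) :=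
  (quotientGlueData k n).ι_isOpenImmersion ⟨f⟩

lemma exists_sliceToQuotient_eq (x : (quotientGlueData k n).glued) :
    ∃ (f : Fin n → List (Fin 3)) (y : slice k f), sliceToQuotient k f y = x := by
  obtain ⟨⟨f⟩, y, hy⟩ := (quotientGlueData k n).ι_jointly_surjective x
  exact ⟨f, y, hy⟩

variable {k}

/-- Points of two slices become equal in the quotient if and only if they are conjugate. -/
lemma comp_sliceToQuotient_eq_iff {a : T ⟶ slice k f} {b : T ⟶ slice k f'} :
    a ≫ sliceToQuotient k f = b ≫ sliceToQuotient k f' ↔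
      PointConj (a ≫ sliceι k f) (b ≫ sliceι k f') := by
  constructor
  · intro h
    let c : T ⟶ (sliceInter k f f').toScheme :=
      PullbackCone.IsLimit.lift ((quotientGlueData k n).vPullbackConeIsLimit ⟨f⟩ ⟨f'⟩) a b h
    have h1 : c ≫ (sliceInter k f f').ι = a :=
      PullbackCone.IsLimit.lift_fst ((quotientGlueData k n).vPullbackConeIsLimit ⟨f⟩ ⟨f'⟩) a b h
    have h2 : c ≫ sliceTransition k f f' ≫ (sliceInter k f' f).ι = b :=
      PullbackCone.IsLimit.lift_snd ((quotientGlueData k n).vPullbackConeIsLimit ⟨f⟩ ⟨f'⟩) a b h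
    have h3 := (sliceTransition_pointConj c).symm
    rw [← h1, ← h2]
    simpa only [Category.assoc] using h3
  · intro h
    obtain ⟨c, rfl⟩ := exists_comp_sliceInter_ι_eq
      (h.symm.isUnit_wordDet (isUnit_wordDet_comp_sliceι b))
    have h1 : c ≫ sliceTransition k f f' ≫ (sliceInter k f' f).ι = b := by
      apply PointConj.slice_eq
      rw [Category.assoc] at h
      have := (sliceTransition_pointConj c).trans h
      simpa only [Category.assoc] using this
    have h2 : sliceTransition k f f' ≫ (sliceInter k f' f).ι ≫ sliceToQuotient k f' =
        (sliceInter k f f').ι ≫ sliceToQuotient k f :=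
      (quotientGlueData k n).glue_condition ⟨f⟩ ⟨f'⟩
    rw [← h1, Category.assoc, Category.assoc, Category.assoc, h2]

variable (k n) in
/-- The structure morphism of the quotient. -/
lemma exists_quotientStr : ∃ s : (quotientGlueData k n).glued ⟶ Spec (CommRingCat.of k),
    ∀ f, sliceToQuotient k f ≫ s = sliceι k f ≫ cyclicTriplesStr k n := by
  have hcompat : ∀ f f' : Fin n → List (Fin 3),
      pullback.fst (sliceToQuotient k f) (sliceToQuotient k f') ≫
          sliceι k f ≫ cyclicTriplesStr k n =
        pullback.snd (sliceToQuotient k f) (sliceToQuotient k f') ≫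
          sliceι k f' ≫ cyclicTriplesStr k n := by
    intro f f'
    have := (comp_sliceToQuotient_eq_iff.1
      (pullback.condition (f := sliceToQuotient k f) (g := sliceToQuotient k f'))).1
    rwa [Category.assoc, Category.assoc] at this
  have h := (quotientGlueData k n).openCover.ι_glueMorphisms
    (fun i => sliceι k i.down ≫ cyclicTriplesStr k n) fun i j => hcompat i.down j.down
  exact ⟨_, fun f => h ⟨f⟩⟩

variable (k n) in
/-- The quotient morphism, characterized by sending each point to the conjugate point in a slice. -/
lemma exists_quotientMap : ∃ π : cyclicTriples k n ⟶ (quotientGlueData k n).glued,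
    ∀ (T : Scheme.{u}) (f : Fin n → List (Fin 3)) (a : T ⟶ slice k f) (p : T ⟶ cyclicTriples k n),
      PointConj (a ≫ sliceι k f) p → p ≫ π = a ≫ sliceToQuotient k f := by
  let V : (Fin n → List (Fin 3)) → (cyclicTriples k n).Opens := fun f =>
    (cyclicTriples k n).basicOpen ((pointTriple (𝟙 (cyclicTriples k n))).wordDet f)
  have hV : ⨆ f, V f = ⊤ := by
    rw [eq_top_iff]
    intro x _
    exact TopologicalSpace.Opens.mem_iSup.2 (exists_mem_basicOpen_wordDet (𝟙 _) x)
  have hu : ∀ f, IsUnit ((pointTriple (V f).ι).wordDet f) := by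
    intro f
    rw [← Category.comp_id (V f).ι, pointTriple_comp, FramedTriple.wordDet_map]
    exact isUnit_ι_appTop_basicOpen le_rfl
  choose r hr using fun f => exists_slice_pointConj (hu f)
  have hcompat : ∀ f f', pullback.fst (V f).ι (V f').ι ≫ r f ≫ sliceToQuotient k f =
      pullback.snd (V f).ι (V f').ι ≫ r f' ≫ sliceToQuotient k f' := by
    intro f f'
    rw [← Category.assoc, ← Category.assoc]
    refine comp_sliceToQuotient_eq_iff.2 ?_
    rw [Category.assoc, Category.assoc]
    have h1 := (hr f).comp (pullback.fst (V f).ι (V f').ι)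
    have h2 := (hr f').comp (pullback.snd (V f).ι (V f').ι)
    rw [pullback.condition] at h1
    exact h1.trans h2.symm
  let 𝒰 := (cyclicTriples k n).openCoverOfIsOpenCover V hV
  have hglue := 𝒰.ι_glueMorphisms (fun f => r f ≫ sliceToQuotient k f) hcompat
  refine ⟨𝒰.glueMorphisms (fun f => r f ≫ sliceToQuotient k f) hcompat, fun T f a p h => ?_⟩
  have hp := h.isUnit_wordDet (isUnit_wordDet_comp_sliceι a)
  rw [← Category.comp_id p, pointTriple_comp, FramedTriple.wordDet_map] at hp
  obtain ⟨b, rfl⟩ := exists_comp_basicOpen_ι_eq hp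
  have hba : (b ≫ r f) ≫ sliceToQuotient k f = a ≫ sliceToQuotient k f := by
    refine comp_sliceToQuotient_eq_iff.2 ?_
    rw [Category.assoc]
    exact ((hr f).comp b).trans h.symm
  exact (Category.assoc _ _ _).trans ((congrArg (b ≫ ·) (hglue f)).trans
    ((Category.assoc _ _ _).symm.trans hba))

/-- The quotient of the scheme of cyclic triples by the general linear group exists. -/
theorem exists_isGLQuotient (k : Type u) [Field k] (n : ℕ) :
    ∃ (M : Scheme.{u}) (s : M ⟶ Spec (CommRingCat.of k)) (π : cyclicTriples k n ⟶ M),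
      IsGLQuotient s π := by
  obtain ⟨s, hs⟩ := exists_quotientStr k n
  obtain ⟨π, hπ⟩ := exists_quotientMap k n
  have hloc : ∀ {T : Scheme.{u}} (p : T ⟶ cyclicTriples k n) (f : Fin n → List (Fin 3))
      (W : T.Opens), W ≤ T.basicOpen ((pointTriple p).wordDet f) →
      ∃ a : W.toScheme ⟶ slice k f, PointConj (a ≫ sliceι k f) (W.ι ≫ p) := by
    intro T p f W hW
    apply exists_slice_pointConj
    rw [pointTriple_comp, FramedTriple.wordDet_map]
    exact isUnit_ι_appTop_basicOpen hW
  refine ⟨_, s, π, ?_, ?_, ?_⟩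
  · refine Scheme.hom_ext_of_forall _ _ fun x => ?_
    obtain ⟨f, hf⟩ := exists_mem_basicOpen_wordDet (𝟙 (cyclicTriples k n)) x
    obtain ⟨a, ha⟩ := hloc (𝟙 _) f _ le_rfl
    refine ⟨_, hf, ?_⟩
    rw [Category.comp_id] at ha
    rw [← Category.assoc, hπ _ _ _ _ ha, Category.assoc, hs, ← ha.1, Category.assoc]
  · intro T p q hpq
    constructor
    · intro h
      choose f hf using exists_mem_basicOpen_wordDet p
      choose f' hf' using exists_mem_basicOpen_wordDet q
      refine (PointConj.of_cover (W := fun x => T.basicOpen ((pointTriple p).wordDet (f x)) ⊓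
        T.basicOpen ((pointTriple q).wordDet (f' x))) (fun x => ⟨x, hf x, hf' x⟩) fun x => ?_).2
      obtain ⟨a, ha⟩ := hloc p (f x) _ (inf_le_left (b := T.basicOpen
        ((pointTriple q).wordDet (f' x))))
      obtain ⟨b, hb⟩ := hloc q (f' x) _ (inf_le_right (a := T.basicOpen
        ((pointTriple p).wordDet (f x))))
      refine ha.symm.trans (PointConj.trans (comp_sliceToQuotient_eq_iff.1 ?_) hb)
      rw [← hπ _ _ _ _ ha, ← hπ _ _ _ _ hb, Category.assoc, Category.assoc, h]
    · intro h
      refine Scheme.hom_ext_of_forall _ _ fun x => ?_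
      obtain ⟨f, hf⟩ := exists_mem_basicOpen_wordDet p x
      obtain ⟨a, ha⟩ := hloc p f _ le_rfl
      refine ⟨_, hf, ?_⟩
      rw [← Category.assoc, ← Category.assoc, hπ _ _ _ _ ha,
        hπ _ _ _ _ (ha.trans (PointConj.comp ⟨hpq, h⟩ _))]
  · intro x
    obtain ⟨f, y, rfl⟩ := exists_sliceToQuotient_eq k x
    refine ⟨(sliceToQuotient k f).opensRange, ⟨y, rfl⟩,
      (sliceToQuotient k f).isoOpensRange.inv ≫ sliceι k f, ?_⟩
    rw [Category.assoc, hπ _ f (𝟙 _) (sliceι k f) (by rw [Category.id_comp]; exact .refl _),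
      Category.id_comp, Scheme.Hom.isoOpensRange_inv_comp]

end quotient
end HilbCrit

end

theorem mainTheorem3 (k : Type u) [Field k] (n : ℕ) :
    -- the quotient `M_n` exists
    (∃ (M : Scheme.{u}) (s : M ⟶ Spec (CommRingCat.of k)) (π : HilbCrit.cyclicTriples k n ⟶ M),
      HilbCrit.IsGLQuotient s π) ∧
    -- and for the quotient `M_n`, the following holds
    (∀ (M : Scheme.{u}) (s : M ⟶ Spec (CommRingCat.of k)) (π : HilbCrit.cyclicTriples k n ⟶ M),
      HilbCrit.IsGLQuotient s π →
      -- `M_n` is smooth and `Tr([A, B] C)` descends to a unique function `f_n` on it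
      Smooth s ∧
      (∃! f : Γ(M, ⊤), π.appTop.hom f = HilbCrit.cyclicPotential k n) ∧
      ∀ f : Γ(M, ⊤), π.appTop.hom f = HilbCrit.cyclicPotential k n →
        -- the critical subscheme `{df_n = 0}`
        ∃ I : M.IdealSheafData, HilbCrit.IsCriticalIdealSheaf s f I ∧
          -- is given by pairwise commutation
          (∀ (T : Scheme.{u}) (p : T ⟶ HilbCrit.cyclicTriples k n),
            (∃ q : T ⟶ I.subscheme, q ≫ I.subschemeι = p ≫ π) ↔
              (HilbCrit.pointTriple p).PairwiseCommute) ∧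
          -- and is the Hilbert scheme, a commuting triple being multiplication by `x, y, z`
          -- on the ring of functions of the corresponding subscheme
          ∃ h : HilbCrit.HilbertSchemeStructure n (I.subschemeι ≫ s),
            ∀ (R : Type u) [CommRing R] [Algebra k R]
              (q : HilbCrit.RingPoint (I.subschemeι ≫ s) R)
              (p : Spec (CommRingCat.of R) ⟶ HilbCrit.cyclicTriples k n),
              q.1 ≫ I.subschemeι = p ≫ π →
                HilbCrit.Describes (HilbCrit.ringPointTriple p) (h.toIdeal R q).1) ∧
    -- the partial derivatives of `Tr([A, B] C)` all vanish exactly at the commuting triples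
    (∀ (R : Type u) [CommRing R] [Algebra k R] (t : HilbCrit.FramedTriple n R),
      (∀ c : HilbCrit.Coord n,
        MvPolynomial.aeval t.coords
          (MvPolynomial.pderiv c (HilbCrit.generic k n).potential) = 0) ↔
        t.PairwiseCommute) := by
  refine ⟨HilbCrit.exists_isGLQuotient k n, fun M s π hπ => ⟨hπ.smooth, hπ.existsUnique_potential,
    fun f hf => ?_⟩, fun R _ _ t => HilbCrit.pderiv_potential_eq_zero_iff t⟩
  obtain ⟨I, hI⟩ := hπ.exists_criticalIdealSheaf f
  obtain ⟨h, hh⟩ := (hπ.isCommutingQuotient hf hI).exists_hilbertSchemeStructure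
  exact ⟨I, hI, fun T p => hπ.exists_comp_subschemeι_iff_pairwiseCommute hf hI p, h,
    fun R _ _ q p hp => hh R q (HilbCrit.ringPointTriple p) ⟨p, rfl, hp⟩⟩
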